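/- Let $p\ge 1$, let $Y$ be a real random variable and $X$ a random vector in $\mathbb{R}^p$ on a common probability space, with $E(Y^2)<\infty$, $E(\|X\|^2)<\infty$, $V(Y)>0$, $V(X)$ nonsingular, and $E(Y\mid X)=\alpha_0+X'\beta_0$ for some $(\alpha_0,\beta_0)\in\mathbb{R}\times\mathbb{R}^p$. Write $A_0=A-E(A)$ for an integrable random variable $A$, $F_A$ for the cdf of a real random variable $A$, $\overline F_A=1-F_A$, $F^{-1}(t)=\inf\{x: F(x)\ge t\}$, and $\mathcal{S}$ for the Euclidean unit sphere of $\mathbb{R}^p$. Let $$\mathcal{B}=\left\{\beta\in\mathbb{R}^p:\ \exists\ \text{random variables } (\widetilde X,\widetilde Y)\ \text{with}\ E(\widetilde Y_0\mid\widetilde X_0)=\widetilde X_0'\beta,\ \widetilde X\overset{d}{=}X,\ \widetilde Y\overset{d}{=}Y\right\}$$ be the identified set and, for $\varepsilon\in(0,1/2)$, $$R(\alpha,F,G)=\frac{\int_\alpha^1F^{-1}(t)\,dt}{\int_\alpha^1G^{-1}(t)\,dt},\qquad S_\varepsilon(F,G)=\min_{\alpha\in[\varepsilon,1-\varepsilon]}R(\alpha,F,G),$$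 $$\mathcal{B}_\varepsilon=\left\{\lambda q:\ q\in\mathcal{S},\ 0\le\lambda\le S_\varepsilon(F_{Y_0},F_{X_0'q})\right\}.$$ Then: 1. For all $\varepsilon\in(0,1/2)$, $\mathcal{B}_\varepsilon$ contains $0$ and is compact and convex. 2. For all $0<\varepsilon<\varepsilon'<1/2$, $\mathcal{B}\subset\mathcal{B}_\varepsilon\subset\mathcal{B}_{\varepsilon'}$, and $\bigcap_{\varepsilon\in(0,1/2)}\mathcal{B}_\varepsilon=\mathcal{B}$. 3. Suppose that $F_Y$ is continuous and that $U:=Y_0-X_0'\beta_0$ satisfies, for all $\lambda>0$, $$\lim_{t\to\infty}\sup_s\frac{\overline F_{\|X_0\|}(\lambda t)}{\overline F_{U\mid X_0'\beta_0=s}(t)}=0,\qquad \lim_{t\to\infty}\sup_s\frac{\overline F_{\|X_0\|}(\lambda t)}{\overline F_{-U\mid X_0'\beta_0=s}(t)}=0,$$ where the suprema are essential suprema with respect to the law of $X_0'\beta_0$ and the denominators are assumed positive for all $t$ and almost every $s$. Then there exists $\varepsilon_0\in(0,1/2)$ such that $\mathcal{B}=\mathcal{B}_\varepsilon$ for all $\varepsilon\in(0,\varepsilon_0]$.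 -/

import Mathlib

open MeasureTheory ProbabilityTheory Set Filter Topology
open scoped ENNReal

noncomputable section

namespace TwoSample

/-- The centred random variable `A₀ = A - E(A)`. -/
def centered {Ω E : Type*} [MeasurableSpace Ω] [NormedAddCommGroup E] [NormedSpace ℝ E]
    (P : Measure Ω) (A : Ω → E) : Ω → E :=
  fun ω => A ω - ∫ ω', A ω' ∂P

/-- The variance matrix `V(X)` of a random vector `X`. -/
def varianceMatrix {Ω : Type*} [MeasurableSpace Ω] {p : ℕ} (P : Measure Ω)
    (X : Ω → EuclideanSpace ℝ (Fin p)) : Matrix (Fin p) (Fin p) ℝ :=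
  Matrix.of fun i j => covariance (fun ω => X ω i) (fun ω => X ω j) P

/-- The real random variable `A'b` (the inner product of the random vector `A` with `b`). -/
def linIndex {Ω : Type*} {p : ℕ} (A : Ω → EuclideanSpace ℝ (Fin p))
    (b : EuclideanSpace ℝ (Fin p)) : Ω → ℝ :=
  fun ω => inner ℝ (A ω) b

/-- The cumulative distribution function `F_A` of a real random variable `A`. -/
def cdfOf {Ω : Type*} [MeasurableSpace Ω] (P : Measure Ω) (A : Ω → ℝ) : ℝ → ℝ :=
  fun x => (P {ω | A ω ≤ x}).toReal

/-- The generalized inverse `F⁻¹(t) = inf {x : F(x) ≥ t}`. -/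
def quantile (F : ℝ → ℝ) (t : ℝ) : ℝ := sInf {x | t ≤ F x}

/-- The ratio of superquantiles
`R(α, F, G) = (∫_α^1 F⁻¹(t) dt) / (∫_α^1 G⁻¹(t) dt)`. -/
def R (α : ℝ) (F G : ℝ → ℝ) : ℝ :=
  (∫ t in α..1, quantile F t) / (∫ t in α..1, quantile G t)

/-- `S_ε(F, G)`, the minimum of `R(α, F, G)` over `α ∈ [ε, 1 - ε]`. -/
def Seps (ε : ℝ) (F G : ℝ → ℝ) : ℝ :=
  sInf ((fun α => R α F G) '' Icc ε (1 - ε))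

/-- The regularized set `B_ε = {l q : ‖q‖ = 1, 0 ≤ l ≤ S_ε(F_{Y₀}, F_{X₀'q})}`. -/
def regularizedSet {Ω : Type*} [MeasurableSpace Ω] {p : ℕ} (P : Measure Ω)
    (X : Ω → EuclideanSpace ℝ (Fin p)) (Y : Ω → ℝ) (ε : ℝ) :
    Set (EuclideanSpace ℝ (Fin p)) :=
  {b | ∃ q : EuclideanSpace ℝ (Fin p), ‖q‖ = 1 ∧ ∃ l : ℝ, 0 ≤ l ∧
    l ≤ Seps ε (cdfOf P (centered P Y)) (cdfOf P (linIndex (centered P X) q)) ∧ b = l • q}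

/-- The identified set `B`: all `b` for which there are random variables `X'`, `Y'` on a common
probability space, with `X'` distributed as `X`, `Y'` distributed as `Y` and
`E(Y'₀ | X'₀) = X'₀'b` almost surely. -/
def identifiedSet {Ω : Type*} [MeasurableSpace Ω] {p : ℕ} (P : Measure Ω)
    (X : Ω → EuclideanSpace ℝ (Fin p)) (Y : Ω → ℝ) : Set (EuclideanSpace ℝ (Fin p)) :=
  {b | ∃ (Ω' : Type) (_ : MeasurableSpace Ω') (P' : Measure Ω')
      (X' : Ω' → EuclideanSpace ℝ (Fin p)) (Y' : Ω' → ℝ),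
    IsProbabilityMeasure P' ∧ Measurable X' ∧ Measurable Y' ∧
    P'.map X' = P.map X ∧ P'.map Y' = P.map Y ∧
    P'[centered P' Y' | MeasurableSpace.comap (centered P' X') inferInstance]
      =ᵐ[P'] linIndex (centered P' X') b}

/-- The tail of `A` is thinner than that of `V` conditional on `W`, uniformly in the value of `W`:
for all `c > 0`, `sup_s P(A > c t) / P(V > t | W = s) → 0` as `t → ∞`.
Conditional laws being determined only up to null sets of values `s`, the supremum is essential
with respect to the law of `W`; the ratios are required to be defined, that is, their denominators
are positive. -/
def ThinnerTail {Ω : Type*} [MeasurableSpace Ω] (P : Measure Ω) [IsFiniteMeasure P]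
    (A V W : Ω → ℝ) : Prop :=
  (∀ t : ℝ, ∀ᵐ s ∂(P.map W), 0 < condDistrib V W P s (Ioi t)) ∧
  ∀ c : ℝ, 0 < c →
    Tendsto (fun t : ℝ =>
        essSup (fun s => P {ω | c * t < A ω} / condDistrib V W P s (Ioi t)) (P.map W))
      atTop (𝓝 (0 : ℝ≥0∞))

end TwoSample

end

open MeasureTheory ProbabilityTheory Set Filter Topology
open scoped ENNReal

noncomputable section

namespace TwoSample

/-! Write SQ_a(A) for the integral of the quantile function of A over (a, 1). A vector b belongs to
the identified set exactly when X₀'b is dominated by Y₀ in the convex order, and for variables with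
equal means this order reads SQ_a(X₀'b) ≤ SQ_a(Y₀) for every a in (0, 1). Necessity is conditional
Jensen (`superquantile_le_of_mem_identifiedSet`). Sufficiency is Strassen's theorem on the line,
proved by an explicit martingale coupling (`exists_uniform_martingale_coupling`) and lifted from
X₀'b to X by disintegration (`exists_coupling_condMean`).

The regularized set keeps the same inequalities only for a in [ε, 1 - ε] (`regularizedSet_eq`).
Since b ↦ SQ_a(X₀'b) is sublinear, and positive off 0 when the variance matrix is nonsingular, each
such set is an intersection of closed convex sets and is bounded. Monotonicity in ε and the formula
for the intersection are then immediate.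

Under the tail condition, both tails of Y₀ = U + X₀'β₀ eventually dominate those of M‖X₀‖, hence
those of X₀'b for all ‖b‖ ≤ M. As a bound M valid for ε = 1/4 also serves every smaller ε, the
inequalities at levels near 0 and 1 hold automatically (`superquantile_le_of_tails_le`). -/

/-! ### Quantile functions -/

/-- Lebesgue measure on the open unit interval. -/
def unitLaw : Measure ℝ := volume.restrict (Ioo 0 1)

instance : IsProbabilityMeasure unitLaw := ⟨by simp [unitLaw]⟩

theorem ae_unitLaw_mem : ∀ᵐ u ∂unitLaw, u ∈ Ioo (0 : ℝ) 1 :=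
  ae_restrict_mem measurableSet_Ioo

theorem intervalIntegral_eq_unitLaw {f : ℝ → ℝ} {a : ℝ} (ha : 0 ≤ a) (ha1 : a ≤ 1) :
    ∫ t in a..1, f t = ∫ t in Ioi a, f t ∂unitLaw := by
  rw [intervalIntegral.integral_of_le ha1, unitLaw, Measure.restrict_restrict measurableSet_Ioi,
    integral_Ioc_eq_integral_Ioo]
  congr 2
  ext t
  simp only [mem_Ioo, mem_inter_iff, mem_Ioi]
  exact ⟨fun h => ⟨h.1, ha.trans_lt h.1, h.2⟩, fun h => ⟨h.1, h.2.2⟩⟩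

/-- Right continuity of the cdf makes the infimum attained. The level lies strictly inside the unit
interval so that the set is nonempty and bounded below; otherwise `sInf` may return its default
value. -/
theorem quantile_le_iff (ρ : Measure ℝ) {t x : ℝ} (ht : t ∈ Ioo (0 : ℝ) 1) :
    quantile (cdf ρ) t ≤ x ↔ t ≤ cdf ρ x := by
  set S : Set ℝ := {x | t ≤ cdf ρ x} with hS
  have hne : S.Nonempty :=
    ((tendsto_cdf_atTop ρ).eventually (eventually_ge_nhds ht.2)).exists
  have hbdd : BddBelow S := by
    obtain ⟨b, hb⟩ := ((tendsto_cdf_atBot ρ).eventually (eventually_lt_nhds ht.1)).exists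
    refine ⟨b, fun y hy => ?_⟩
    by_contra! h
    exact absurd (monotone_cdf ρ h.le) (not_le.2 (hb.trans_le hy))
  have hmem : t ≤ cdf ρ (sInf S) := by
    have h1 : Tendsto (cdf ρ) (𝓝[>] sInf S) (𝓝 (cdf ρ (sInf S))) :=
      ((cdf ρ).right_continuous (sInf S)).mono_left (nhdsWithin_mono _ Ioi_subset_Ici_self)
    refine ge_of_tendsto h1 ?_
    filter_upwards [self_mem_nhdsWithin] with y hy
    obtain ⟨z, hz, hzy⟩ := exists_lt_of_csInf_lt hne hy
    exact le_trans hz (monotone_cdf ρ hzy.le)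
  exact ⟨fun h => hmem.trans (monotone_cdf ρ h), fun h => csInf_le hbdd h⟩

theorem quantile_monotoneOn (ρ : Measure ℝ) : MonotoneOn (quantile (cdf ρ)) (Ioo 0 1) := by
  intro s hs t ht hst
  rw [quantile_le_iff ρ hs]
  exact hst.trans ((quantile_le_iff ρ ht).1 le_rfl)

theorem aemeasurable_quantile (ρ : Measure ℝ) : AEMeasurable (quantile (cdf ρ)) unitLaw :=
  aemeasurable_restrict_of_monotoneOn measurableSet_Ioo (quantile_monotoneOn ρ)

theorem map_quantile (ρ : Measure ℝ) [IsProbabilityMeasure ρ] :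
    unitLaw.map (quantile (cdf ρ)) = ρ := by
  have := Measure.isProbabilityMeasure_map (aemeasurable_quantile ρ)
  refine Measure.ext_of_Iic _ _ fun x => ?_
  rw [Measure.map_apply_of_aemeasurable (aemeasurable_quantile ρ) measurableSet_Iic,
    ← ofReal_cdf ρ x]
  have h1 : unitLaw (quantile (cdf ρ) ⁻¹' Iic x) = unitLaw (Ioc 0 (cdf ρ x)) := by
    refine measure_congr ?_
    filter_upwards [ae_unitLaw_mem] with t ht
    refine propext ?_
    change quantile (cdf ρ) t ≤ x ↔ 0 < t ∧ t ≤ cdf ρ x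
    rw [quantile_le_iff ρ ht]
    exact ⟨fun h => ⟨ht.1, h⟩, fun h => h.2⟩
  rw [h1, unitLaw, restrict_Ioo_eq_restrict_Ioc, Measure.restrict_apply measurableSet_Ioc,
    Ioc_inter_Ioc, max_self, min_eq_left (cdf_le_one ρ x)]
  simp

theorem integral_comp_quantile (ρ : Measure ℝ) [IsProbabilityMeasure ρ] {f : ℝ → ℝ}
    (hf : Measurable f) : ∫ t, f (quantile (cdf ρ) t) ∂unitLaw = ∫ x, f x ∂ρ := by
  conv_rhs => rw [← map_quantile ρ]
  rw [integral_map (aemeasurable_quantile ρ) hf.aestronglyMeasurable]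

theorem integrable_quantile {ρ : Measure ℝ} [IsProbabilityMeasure ρ] (h : Integrable id ρ) :
    Integrable (quantile (cdf ρ)) unitLaw := by
  rw [← map_quantile ρ] at h
  exact (integrable_map_measure aestronglyMeasurable_id (aemeasurable_quantile ρ)).1 h

theorem measureReal_unitLaw_Ioi {a : ℝ} (ha : 0 ≤ a) (ha1 : a ≤ 1) :
    unitLaw.real (Ioi a) = 1 - a := by
  have : Ioi a ∩ Ioo 0 1 = Ioo a 1 := by
    ext t
    simp only [mem_Ioo, mem_inter_iff, mem_Ioi]
    exact ⟨fun h => ⟨h.1, h.2.2⟩, fun h => ⟨h.1, ha.trans_lt h.1, h.2⟩⟩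
  rw [unitLaw, measureReal_def, Measure.restrict_apply measurableSet_Ioi, this, Real.volume_Ioo,
    ENNReal.toReal_ofReal (by linarith)]

/-! ### Superquantiles of random variables -/

section Superquantile

variable {Ω : Type*} [MeasurableSpace Ω] {P : Measure Ω}

/-- The integrated upper quantile `∫_a^1 F_A⁻¹(t) dt`. -/
def superquantile (P : Measure Ω) (A : Ω → ℝ) (a : ℝ) : ℝ :=
  ∫ t in a..1, quantile (cdfOf P A) t

theorem integrable_id_map {A : Ω → ℝ} (hA : Measurable A) (hi : Integrable A P) :
    Integrable id (P.map A) :=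
  (integrable_map_measure aestronglyMeasurable_id hA.aemeasurable).2 hi

theorem superquantile_congr {Ω' : Type*} [MeasurableSpace Ω'] {P' : Measure Ω'}
    {A : Ω → ℝ} {B : Ω' → ℝ} (hA : Measurable A) (hB : Measurable B)
    (h : P'.map B = P.map A) : superquantile P' B = superquantile P A := by
  have hc : cdfOf P' B = cdfOf P A := by
    ext x
    have := congrArg (fun μ => μ (Iic x)) h
    simp only [Measure.map_apply hA measurableSet_Iic, Measure.map_apply hB measurableSet_Iic]
      at this
    exact congrArg ENNReal.toReal this
  ext a
  rw [superquantile, superquantile, hc]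

variable [IsProbabilityMeasure P]

theorem cdfOf_eq_cdf_map {A : Ω → ℝ} (hA : Measurable A) : cdfOf P A = cdf (P.map A) := by
  have := Measure.isProbabilityMeasure_map (μ := P) hA.aemeasurable
  ext x
  rw [cdf_eq_real, measureReal_def, Measure.map_apply hA measurableSet_Iic]
  rfl

theorem integrable_excess {A : Ω → ℝ} (hi : Integrable A P) (c : ℝ) :
    Integrable (fun ω => max (A ω - c) 0) P :=
  (hi.sub (integrable_const c)).pos_part

theorem superquantile_sub {A : Ω → ℝ} (hA : Measurable A) (hi : Integrable A P)
    {a : ℝ} (ha : a ∈ Ioo (0 : ℝ) 1) (c : ℝ) :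
    superquantile P A a - (1 - a) * c
      = ∫ t, (Ioi a).indicator (fun t => quantile (cdfOf P A) t - c) t ∂unitLaw := by
  have := Measure.isProbabilityMeasure_map (μ := P) hA.aemeasurable
  rw [integral_indicator measurableSet_Ioi, superquantile,
    intervalIntegral_eq_unitLaw ha.1.le ha.2.le, cdfOf_eq_cdf_map hA,
    integral_sub (integrable_quantile (integrable_id_map hA hi)).integrableOn
      (integrable_const c).integrableOn, setIntegral_const,
    measureReal_unitLaw_Ioi ha.1.le ha.2.le, smul_eq_mul]

theorem integral_excess_eq {A : Ω → ℝ} (hA : Measurable A) (c : ℝ) :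
    ∫ ω, max (A ω - c) 0 ∂P = ∫ t, max (quantile (cdfOf P A) t - c) 0 ∂unitLaw := by
  have := Measure.isProbabilityMeasure_map (μ := P) hA.aemeasurable
  have hm : Measurable fun x : ℝ => max (x - c) 0 := by fun_prop
  rw [cdfOf_eq_cdf_map hA, integral_comp_quantile _ hm,
    integral_map hA.aemeasurable hm.aestronglyMeasurable]

/-- Half of the Rockafellar–Uryasev formula: the superquantile is the minimum over c of (1 - a)c +
E(A - c)⁺. With q the quantile function, q - c restricted to (a, 1) is at most (q - c)⁺. For c =
q(a), monotonicity of q turns this into an equality, which is `superquantile_eq`. -/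
theorem superquantile_le {A : Ω → ℝ} (hA : Measurable A) (hi : Integrable A P)
    {a : ℝ} (ha : a ∈ Ioo (0 : ℝ) 1) (c : ℝ) :
    superquantile P A a ≤ (1 - a) * c + ∫ ω, max (A ω - c) 0 ∂P := by
  have := Measure.isProbabilityMeasure_map (μ := P) hA.aemeasurable
  have hq : Integrable (fun t => quantile (cdfOf P A) t - c) unitLaw := by
    rw [cdfOf_eq_cdf_map hA]
    exact (integrable_quantile (integrable_id_map hA hi)).sub (integrable_const c)
  rw [← sub_le_iff_le_add', superquantile_sub hA hi ha, integral_excess_eq hA]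
  refine integral_mono (hq.indicator measurableSet_Ioi) hq.pos_part fun t => ?_
  by_cases ht : t ∈ Ioi a
  · rw [indicator_of_mem ht]; exact le_max_left _ _
  · rw [indicator_of_notMem ht]; exact le_max_right _ _

theorem superquantile_eq {A : Ω → ℝ} (hA : Measurable A) (hi : Integrable A P)
    {a : ℝ} (ha : a ∈ Ioo (0 : ℝ) 1) :
    superquantile P A a = (1 - a) * quantile (cdfOf P A) a
      + ∫ ω, max (A ω - quantile (cdfOf P A) a) 0 ∂P := by
  rw [← sub_eq_iff_eq_add', superquantile_sub hA hi ha, integral_excess_eq hA]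
  refine integral_congr_ae ?_
  filter_upwards [ae_unitLaw_mem] with t ht
  rw [cdfOf_eq_cdf_map hA]
  by_cases hta : t ∈ Ioi a
  · rw [indicator_of_mem hta, max_eq_left]
    exact sub_nonneg.2 (quantile_monotoneOn _ ha ht (le_of_lt hta))
  · rw [indicator_of_notMem hta, max_eq_right]
    exact sub_nonpos.2 (quantile_monotoneOn _ ht ha (not_lt.1 hta))

/-- The sum of the two quantiles is an admissible c in the variational bound for A + B, and the
positive part is subadditive. -/
theorem superquantile_add_le {A B : Ω → ℝ} (hA : Measurable A) (hiA : Integrable A P)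
    (hB : Measurable B) (hiB : Integrable B P) {a : ℝ} (ha : a ∈ Ioo (0 : ℝ) 1) :
    superquantile P (fun ω => A ω + B ω) a ≤ superquantile P A a + superquantile P B a := by
  set c := quantile (cdfOf P A) a with hc
  set d := quantile (cdfOf P B) a with hd
  have h1 := superquantile_le (hA.add hB) (hiA.add hiB) ha (c + d)
  rw [superquantile_eq hA hiA ha, superquantile_eq hB hiB ha, ← hc, ← hd]
  have h2 : ∫ ω, max ((A + B) ω - (c + d)) 0 ∂P
      ≤ ∫ ω, max (A ω - c) 0 ∂P + ∫ ω, max (B ω - d) 0 ∂P := by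
    rw [← integral_add (integrable_excess hiA c) (integrable_excess hiB d)]
    refine integral_mono (integrable_excess (hiA.add hiB) _)
      ((integrable_excess hiA c).add (integrable_excess hiB d)) fun ω => ?_
    simp only [Pi.add_apply]
    refine max_le ?_ (add_nonneg (le_max_right _ _) (le_max_right _ _))
    linarith [le_max_left (A ω - c) 0, le_max_left (B ω - d) 0]
  change superquantile P (A + B) a ≤ _
  linarith

/-- Let c be the quantile at a. If c < 0, then E(A - c)⁺ ≥ -c and the total is at least -ac > 0. If
c > 0, the term (1 - a)c is positive. If c = 0, a vanishing E(A⁺) together with mean zero would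
force A = 0 almost surely. -/
theorem superquantile_pos {A : Ω → ℝ} (hA : Measurable A) (hiA : Integrable A P)
    (h0 : ∫ ω, A ω ∂P = 0) {a : ℝ} (ha : a ∈ Ioo (0 : ℝ) 1) (hne : ¬ A =ᵐ[P] 0) :
    0 < superquantile P A a := by
  rw [superquantile_eq hA hiA ha]
  set c := quantile (cdfOf P A) a with hc
  have hi := integrable_excess hiA c
  have hnn : 0 ≤ ∫ ω, max (A ω - c) 0 ∂P := integral_nonneg fun ω => le_max_right _ _
  rcases lt_trichotomy c 0 with h | h | h
  · have h1 : ∫ ω, (A ω - c) ∂P ≤ ∫ ω, max (A ω - c) 0 ∂P :=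
      integral_mono (hiA.sub (integrable_const c)) hi fun ω => le_max_left _ _
    rw [integral_sub hiA (integrable_const c), h0] at h1
    simp only [integral_const, probReal_univ, one_smul] at h1
    nlinarith [ha.1]
  · rw [h] at hnn hi ⊢
    rw [mul_zero, zero_add]
    refine lt_of_le_of_ne hnn fun h1 => hne ?_
    have h2 := (integral_eq_zero_iff_of_nonneg (fun ω => le_max_right _ _) hi).1 h1.symm
    have h3 : ∀ᵐ ω ∂P, A ω ≤ 0 := by
      filter_upwards [h2] with ω hω
      have := le_max_left (A ω - 0) 0
      simp only [Pi.zero_apply] at hω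
      linarith
    have h4 := (integral_eq_zero_iff_of_nonneg_ae (f := fun ω => - A ω)
      (by filter_upwards [h3] with ω hω; simpa using hω) hiA.neg).1 (by rw [integral_neg, h0, neg_zero])
    filter_upwards [h4] with ω hω
    simpa using hω
  · have := ha.2
    have : 0 < (1 - a) * c := mul_pos (by linarith) h
    linarith

theorem superquantile_zero {a : ℝ} (ha : a ∈ Ioo (0 : ℝ) 1) :
    superquantile P (fun _ => 0) a = 0 := by
  refine le_antisymm ?_ ?_
  · simpa using superquantile_le (P := P) measurable_const (integrable_const 0) ha 0
  · rw [superquantile_eq measurable_const (integrable_const 0) ha]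
    set c := quantile (cdfOf P fun _ => 0) a
    simp only [integral_const, probReal_univ, one_smul]
    rcases le_total c 0 with h | h
    · have := le_max_left (0 - c) 0
      nlinarith [ha.1]
    · have := le_max_right (0 - c) 0
      nlinarith [ha.2, mul_nonneg (sub_nonneg.2 ha.2.le) h]

theorem superquantile_nonneg {A : Ω → ℝ} (hA : Measurable A) (hiA : Integrable A P)
    (h0 : ∫ ω, A ω ∂P = 0) {a : ℝ} (ha : a ∈ Ioo (0 : ℝ) 1) :
    0 ≤ superquantile P A a := by
  by_cases h : A =ᵐ[P] 0
  · have : P.map A = P.map fun _ => (0 : ℝ) := Measure.map_congr h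
    rw [superquantile_congr measurable_const hA this, superquantile_zero ha]
  · exact (superquantile_pos hA hiA h0 ha h).le

theorem superquantile_mul_le {A : Ω → ℝ} (hA : Measurable A) (hiA : Integrable A P)
    {a : ℝ} (ha : a ∈ Ioo (0 : ℝ) 1) {l : ℝ} (hl : 0 ≤ l) :
    superquantile P (fun ω => l * A ω) a ≤ l * superquantile P A a := by
  rw [superquantile_eq hA hiA ha]
  set c := quantile (cdfOf P A) a
  refine (superquantile_le (hA.const_mul l) (hiA.const_mul l) ha (l * c)).trans (le_of_eq ?_)
  rw [mul_add, ← integral_const_mul]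
  congr 1
  · ring
  · refine integral_congr_ae (ae_of_all _ fun ω => ?_)
    simp only [← mul_sub, mul_max_of_nonneg _ _ hl, mul_zero]

theorem superquantile_mul {A : Ω → ℝ} (hA : Measurable A) (hiA : Integrable A P)
    {a : ℝ} (ha : a ∈ Ioo (0 : ℝ) 1) {l : ℝ} (hl : 0 ≤ l) :
    superquantile P (fun ω => l * A ω) a = l * superquantile P A a := by
  rcases hl.eq_or_lt with rfl | hl'
  · simp only [zero_mul]
    exact superquantile_zero ha
  refine le_antisymm (superquantile_mul_le hA hiA ha hl) ?_
  have h := superquantile_mul_le (hA.const_mul l) (hiA.const_mul l) ha (inv_nonneg.2 hl)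
  simp only [← mul_assoc, inv_mul_cancel₀ hl'.ne', one_mul] at h
  calc l * superquantile P A a ≤ l * (l⁻¹ * superquantile P (fun ω => l * A ω) a) := by gcongr
    _ = _ := by rw [← mul_assoc, mul_inv_cancel₀ hl'.ne', one_mul]

/-- The superquantiles of `A` are dominated by those of `B` at a level where the excess function of
`A` is dominated by that of `B` at the quantile of `B`. -/
theorem superquantile_le_of_excess_le {A B : Ω → ℝ} (hA : Measurable A) (hiA : Integrable A P)
    (hB : Measurable B) (hiB : Integrable B P) {a : ℝ} (ha : a ∈ Ioo (0 : ℝ) 1)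
    (h : ∫ ω, max (A ω - quantile (cdfOf P B) a) 0 ∂P
      ≤ ∫ ω, max (B ω - quantile (cdfOf P B) a) 0 ∂P) :
    superquantile P A a ≤ superquantile P B a := by
  rw [superquantile_eq hB hiB ha]
  linarith [superquantile_le hA hiA ha (quantile (cdfOf P B) a)]

end Superquantile

/-! ### Martingale couplings on the line -/

/-- Stochastically ordered finite measures of equal mass have a monotone coupling. -/
theorem exists_coupling_le (μ ν : Measure ℝ) [IsFiniteMeasure μ] [IsFiniteMeasure ν]
    (huniv : μ univ = ν univ) (h : ∀ x, ν (Iic x) ≤ μ (Iic x)) :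
    ∃ G : Measure (ℝ × ℝ), G.fst = μ ∧ G.snd = ν ∧ ∀ᵐ z ∂G, z.1 ≤ z.2 := by
  by_cases h0 : μ univ = 0
  · refine ⟨0, ?_, ?_, by simp⟩
    · rw [Measure.fst_zero, Measure.measure_univ_eq_zero.1 h0]
    · rw [Measure.snd_zero, Measure.measure_univ_eq_zero.1 (huniv.symm.trans h0)]
  have htop : μ univ ≠ ∞ := measure_ne_top _ _
  set T := μ univ with hT
  have hp : ∀ ρ : Measure ℝ, ρ univ = T → IsProbabilityMeasure (T⁻¹ • ρ) := fun ρ hρ =>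
    ⟨by rw [Measure.smul_apply, hρ, smul_eq_mul, ENNReal.inv_mul_cancel h0 htop]⟩
  have hs : ∀ ρ : Measure ℝ, T • (T⁻¹ • ρ) = ρ := fun ρ => by
    rw [smul_smul, ENNReal.mul_inv_cancel h0 htop, one_smul]
  have := hp μ rfl
  have := hp ν huniv.symm
  have hqm := aemeasurable_quantile (T⁻¹ • μ)
  have hqn := aemeasurable_quantile (T⁻¹ • ν)
  have hz := hqm.prodMk hqn
  -- The comonotone coupling: both normalised quantile functions are evaluated at the same uniform
  -- variable, and the ordering of the cdfs becomes a pointwise ordering of the quantiles.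
  refine ⟨T • unitLaw.map fun t => (quantile (cdf (T⁻¹ • μ)) t, quantile (cdf (T⁻¹ • ν)) t),
    ?_, ?_, ?_⟩
  · rw [Measure.fst, Measure.map_smul, AEMeasurable.map_map_of_aemeasurable
      measurable_fst.aemeasurable hz]
    exact (congrArg (T • ·) (map_quantile (T⁻¹ • μ))).trans (hs μ)
  · rw [Measure.snd, Measure.map_smul, AEMeasurable.map_map_of_aemeasurable
      measurable_snd.aemeasurable hz]
    exact (congrArg (T • ·) (map_quantile (T⁻¹ • ν))).trans (hs ν)
  · refine Measure.ae_smul_measure ?_ T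
    rw [ae_map_iff hz (measurableSet_le measurable_fst measurable_snd)]
    filter_upwards [ae_unitLaw_mem] with t ht
    rw [quantile_le_iff _ ht]
    refine ((quantile_le_iff (T⁻¹ • ν) ht).1 le_rfl).trans ?_
    rw [cdf_eq_real, cdf_eq_real]
    refine ENNReal.toReal_mono (measure_ne_top _ _) ?_
    simp only [Measure.smul_apply, smul_eq_mul]
    exact mul_le_mul_right (h _) _

section Exchange

variable {m n : ℝ → ℝ}

theorem ae_of_ae_fst {G : Measure (ℝ × ℝ)} {μ : Measure ℝ} (h : G.fst = μ) {p : ℝ → Prop}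
    (hp : ∀ᵐ u ∂μ, p u) : ∀ᵐ z ∂G, p z.1 :=
  ae_of_ae_map measurable_fst.aemeasurable (by rwa [← Measure.fst, h])

theorem ae_of_ae_snd {G : Measure (ℝ × ℝ)} {μ : Measure ℝ} (h : G.snd = μ) {p : ℝ → Prop}
    (hp : ∀ᵐ u ∂μ, p u) : ∀ᵐ z ∂G, p z.2 :=
  ae_of_ae_map measurable_snd.aemeasurable (by rwa [← Measure.snd, h])

theorem ae_withDensity_ofReal {f : ℝ → ℝ} (hf : Measurable f) :
    ∀ᵐ u ∂(unitLaw.withDensity fun u => ENNReal.ofReal (f u)), u ∈ Ioo (0 : ℝ) 1 ∧ 0 < f u := by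
  rw [ae_withDensity_iff hf.ennreal_ofReal]
  filter_upwards [ae_unitLaw_mem] with u hu hne
  exact ⟨hu, by simpa using hne⟩

/-- A density bounded by `1 / f` turns the measure with density `f` into a measure dominated by
`unitLaw` on `{f > 0}`. -/
theorem withDensity_map_le {G : Measure (ℝ × ℝ)} {π : ℝ × ℝ → ℝ} (hπ : Measurable π)
    {f : ℝ → ℝ} (hf : Measurable f)
    (hG : G.map π = unitLaw.withDensity fun u => ENNReal.ofReal (f u))
    {w : ℝ × ℝ → ℝ≥0∞} (hw : ∀ᵐ z ∂G, w z ≤ ENNReal.ofReal (f (π z))⁻¹) :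
    (G.withDensity w).map π ≤ unitLaw.restrict {u | 0 < f u} := by
  have hpos : MeasurableSet {u | 0 < f u} := measurableSet_lt measurable_const hf
  have hinv : Measurable fun u => ENNReal.ofReal (f u)⁻¹ := hf.inv.ennreal_ofReal
  refine Measure.le_iff.2 fun s hs => ?_
  rw [Measure.map_apply hπ hs, withDensity_apply _ (hπ hs), Measure.restrict_apply hs]
  calc ∫⁻ z in π ⁻¹' s, w z ∂G
      ≤ ∫⁻ z in π ⁻¹' s, ENNReal.ofReal (f (π z))⁻¹ ∂G :=
        lintegral_mono_ae (ae_restrict_of_ae hw)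
    _ = ∫⁻ u in s, ENNReal.ofReal (f u)⁻¹ ∂(G.map π) :=
        (setLIntegral_map hs hinv hπ).symm
    _ = ∫⁻ u in s, ENNReal.ofReal (f u) * ENNReal.ofReal (f u)⁻¹ ∂unitLaw := by
        rw [hG, setLIntegral_withDensity_eq_setLIntegral_mul _ hf.ennreal_ofReal
          hinv hs]
        rfl
    _ ≤ ∫⁻ u in s, {u | 0 < f u}.indicator 1 u ∂unitLaw := by
        refine lintegral_mono fun u => ?_
        by_cases hu : 0 < f u
        · rw [indicator_of_mem (show u ∈ {u | 0 < f u} from hu), ← ENNReal.ofReal_mul hu.le,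
            mul_inv_cancel₀ hu.ne']
          simp
        · rw [ENNReal.ofReal_of_nonpos (not_lt.1 hu)]
          simp
    _ = unitLaw (s ∩ {u | 0 < f u}) := by
        rw [lintegral_indicator_one hpos, Measure.restrict_apply hpos, inter_comm]

/-- The inverse transform martingale coupling: if the quantile function `m` is majorized by `n`,
there is a coupling of two uniform variables `U`, `V` with `E(n(V) | U) = m(U)`. -/
theorem exists_uniform_martingale_coupling (hm : Measurable m) (hn : Measurable n)
    (hmm : MonotoneOn m (Ioo 0 1))
    (him : Integrable m unitLaw) (hin : Integrable n unitLaw)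
    (htot : ∫ u, m u ∂unitLaw = ∫ u, n u ∂unitLaw)
    (hle : ∀ x, ∫ u in Ioi x, m u ∂unitLaw ≤ ∫ u in Ioi x, n u ∂unitLaw) :
    ∃ ρ : Measure (ℝ × ℝ), ρ.fst = unitLaw ∧ ρ.snd = unitLaw ∧
      ∀ B, MeasurableSet B → ∫ z in Prod.fst ⁻¹' B, n z.2 ∂ρ = ∫ u in B, m u ∂unitLaw := by
  have hDm : Measurable fun u => m u - n u := hm.sub hn
  have hEm : Measurable fun u => n u - m u := hn.sub hm
  have hDi : Integrable (fun u => m u - n u) unitLaw := him.sub hin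
  have hEi : Integrable (fun u => n u - m u) unitLaw := hin.sub him
  -- Starting from U = V, the conditional mean of n(V) is n(U): too small where `μ` lives, too large
  -- where `ν` lives. The plan is to match these defects and exchange mass between matched points.
  set μ := unitLaw.withDensity fun u => ENNReal.ofReal (m u - n u) with hμ
  set ν := unitLaw.withDensity fun u => ENNReal.ofReal (n u - m u) with hν
  have hfμ : IsFiniteMeasure μ := isFiniteMeasure_withDensity_ofReal hDi.2
  have hfν : IsFiniteMeasure ν := isFiniteMeasure_withDensity_ofReal hEi.2
  have hdiff : ∀ s, MeasurableSet s →
      ∫ u in s, (m u - n u) ∂unitLaw = μ.real s - ν.real s := fun s hs => by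
    rw [integral_eq_lintegral_pos_part_sub_lintegral_neg_part hDi.integrableOn, measureReal_def,
      measureReal_def, hμ, hν, withDensity_apply _ hs, withDensity_apply _ hs]
    simp only [neg_sub]
  -- With equal totals, majorization of the upper tails says that m - n has nonnegative integral
  -- over each Iic x, so the deficit `μ` can be transported rightwards onto the surplus `ν`.
  -- Monotonicity of m then gives n(u) < m(u) ≤ m(v) < n(v) for matched (u, v).
  obtain ⟨G, hG1, hG2, hGle⟩ := exists_coupling_le μ ν
    (by
      have h := hdiff univ MeasurableSet.univ
      rw [Measure.restrict_univ, integral_sub him hin, htot, sub_self] at h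
      exact (ENNReal.toReal_eq_toReal_iff' (measure_ne_top _ _) (measure_ne_top _ _)).1
        (sub_eq_zero.1 h.symm))
    (fun x => by
      have h := hdiff (Iic x) measurableSet_Iic
      have h1 := integral_add_compl (measurableSet_Iic (a := x)) hDi
      have h2 := integral_sub (him.integrableOn (s := Ioi x)) (hin.integrableOn (s := Ioi x))
      rw [compl_Iic, integral_sub him hin, htot, sub_self] at h1
      refine (ENNReal.toReal_le_toReal (measure_ne_top _ _) (measure_ne_top _ _)).1 ?_
      have := hle x
      simp only [measureReal_def] at h
      linarith)
  have hfG : IsFiniteMeasure G := ⟨by rw [← Measure.fst_univ, hG1]; exact measure_lt_top _ _⟩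
  have hmem : ∀ᵐ z ∂G, n z.1 < m z.1 ∧ m z.1 ≤ m z.2 ∧ m z.2 < n z.2 := by
    filter_upwards [ae_of_ae_fst hG1 (ae_withDensity_ofReal hDm),
      ae_of_ae_snd hG2 (ae_withDensity_ofReal hEm), hGle] with z h1 h2 h3
    exact ⟨sub_pos.1 h1.2, hmm h1.1 h2.1 h3, sub_pos.1 h2.2⟩
  -- Moving mass w from (u, u) to (u, v) raises the integral of n(V) over U = u by w(n(v) - n(u));
  -- this weight makes the change equal to the mass of `G`.
  set w : ℝ × ℝ → NNReal := fun z => Real.toNNReal (n z.2 - n z.1)⁻¹ with hw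
  have hwm : Measurable w :=
    (((hn.comp measurable_snd).sub (hn.comp measurable_fst)).inv).real_toNNReal
  set H := G.withDensity fun z => (w z : ℝ≥0∞) with hH
  have hH1 : H.fst ≤ unitLaw.restrict {u | 0 < m u - n u} := by
    refine withDensity_map_le measurable_fst hDm hG1 ?_
    filter_upwards [hmem] with z hz
    refine ENNReal.ofReal_le_ofReal (inv_anti₀ (sub_pos.2 hz.1) ?_)
    linarith [hz.2.1, hz.2.2]
  have hH2 : H.snd ≤ unitLaw.restrict {u | 0 < n u - m u} := by
    refine withDensity_map_le measurable_snd hEm hG2 ?_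
    filter_upwards [hmem] with z hz
    refine ENNReal.ofReal_le_ofReal (inv_anti₀ (sub_pos.2 hz.2.2) ?_)
    linarith [hz.2.1, hz.1]
  -- There is enough uniform mass for the exchange: n(v) - n(u) is at least m(u) - n(u) and at least
  -- n(v) - m(v), and the two marginals of `H` sit on disjoint sets.
  have hsum : H.fst + H.snd ≤ unitLaw := by
    refine (add_le_add hH1 hH2).trans ?_
    rw [← Measure.restrict_union _ (measurableSet_lt measurable_const hEm)]
    · exact Measure.restrict_le_self
    · refine disjoint_left.2 fun u (h1 : 0 < m u - n u) (h2 : 0 < n u - m u) => ?_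
      linarith
  have hH1' : H.fst ≤ unitLaw := hH1.trans Measure.restrict_le_self
  have hH2' : H.snd ≤ unitLaw := hH2.trans Measure.restrict_le_self
  have hfH1 : IsFiniteMeasure H.fst := isFiniteMeasure_of_le unitLaw hH1'
  have hfH2 : IsFiniteMeasure H.snd := isFiniteMeasure_of_le unitLaw hH2'
  have hfH : IsFiniteMeasure H := ⟨by rw [← Measure.fst_univ]; exact measure_lt_top _ _⟩
  -- The mass not exchanged remains on the diagonal. Adding `H` and its reflection restores both
  -- uniform marginals.
  set K := unitLaw - (H.fst + H.snd) with hK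
  have hKadd : K + (H.fst + H.snd) = unitLaw := Measure.sub_add_cancel_of_le hsum
  have hKle : K ≤ unitLaw := Measure.sub_le
  have hdiag : Measurable fun u : ℝ => (u, u) := measurable_id.prodMk measurable_id
  refine ⟨K.map (fun u => (u, u)) + H + H.map Prod.swap, ?_, ?_, fun B hB => ?_⟩
  · rw [Measure.fst_add, Measure.fst_add, Measure.fst_map_swap, Measure.fst,
      Measure.map_map measurable_fst hdiag, add_assoc]
    exact (congrArg (· + _) Measure.map_id).trans hKadd
  · rw [Measure.snd_add, Measure.snd_add, Measure.snd_map_swap, Measure.snd,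
      Measure.map_map measurable_snd hdiag, add_assoc, add_comm H.snd]
    exact (congrArg (· + _) Measure.map_id).trans hKadd
  · set f : ℝ → ℝ := B.indicator 1 with hf
    have hfm : Measurable f := measurable_one.indicator hB
    have hfb : ∀ u, ‖f u‖ ≤ 1 := fun u => by
      rw [hf]; by_cases hu : u ∈ B <;> simp [hu]
    have hfi : ∀ {α : Type} [MeasurableSpace α] {ρ : Measure α} {g : α → ℝ} {π : α → ℝ},
        Measurable π → Integrable g ρ → Integrable (fun z => f (π z) * g z) ρ :=
      fun hπ hg => hg.bdd_mul (hfm.comp hπ).aestronglyMeasurable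
        (ae_of_all _ fun z => hfb _)
    have hn1 : Integrable (fun z => n z.1) H :=
      (hin.mono_measure hH1').comp_measurable measurable_fst
    have hn2 : Integrable (fun z => n z.2) H :=
      (hin.mono_measure hH2').comp_measurable measurable_snd
    have hset : ∀ {α : Type} [MeasurableSpace α] (ρ : Measure α) (g π : α → ℝ), Measurable π →
        ∫ z in π ⁻¹' B, g z ∂ρ = ∫ z, f (π z) * g z ∂ρ := fun ρ g π hπ => by
      rw [← integral_indicator (hπ hB)]
      congr 1
      ext z
      by_cases hz : π z ∈ B
      · rw [indicator_of_mem (show z ∈ π ⁻¹' B from hz)]; simp [hf, hz]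
      · rw [indicator_of_notMem (show z ∉ π ⁻¹' B from hz)]; simp [hf, hz]
    have hgm : Measurable fun z : ℝ × ℝ => f z.1 * n z.2 :=
      (hfm.comp measurable_fst).mul (hn.comp measurable_snd)
    have hIK : Integrable (fun u => f u * n u) K :=
      (hfi measurable_id (hin.mono_measure hKle) :)
    have hI1 : Integrable (fun z => f z.1 * n z.2) (K.map fun u => (u, u)) :=
      (integrable_map_measure hgm.aestronglyMeasurable hdiag.aemeasurable).2 hIK
    have hI12 : Integrable (fun z => f z.1 * n z.2) H := hfi measurable_fst hn2
    have hI21 : Integrable (fun z => f z.2 * n z.1) H := hfi measurable_snd hn1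
    have hI11 : Integrable (fun z => f z.1 * n z.1) H := hfi measurable_fst hn1
    have hI22 : Integrable (fun z => f z.2 * n z.2) H := hfi measurable_snd hn2
    have hI3 : Integrable (fun z => f z.1 * n z.2) (H.map Prod.swap) :=
      (integrable_map_measure hgm.aestronglyMeasurable measurable_swap.aemeasurable).2 hI21
    have hfn : Measurable fun u => f u * n u := hfm.mul hn
    rw [hset _ _ _ measurable_fst, integral_add_measure (hI1.add_measure hI12) hI3,
      integral_add_measure hI1 hI12, integral_map hdiag.aemeasurable hgm.aestronglyMeasurable,
      integral_map measurable_swap.aemeasurable hgm.aestronglyMeasurable]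
    simp only [Prod.fst_swap, Prod.snd_swap]
    -- Relative to the diagonal coupling, the exchange alters the integral of f(U)n(V) by ∫ (f(u) -
    -- f(v))(n(v) - n(u)) dH. The weight reduces this to ∫ (f(u) - f(v)) dG = μ(B) - ν(B), which is
    -- the integral of m - n over B.
    have hKint : ∫ u, f u * n u ∂unitLaw = ∫ u, f u * n u ∂K
        + (∫ z, f z.1 * n z.1 ∂H + ∫ z, f z.2 * n z.2 ∂H) := by
      have h1 : ∫ z, f z.1 * n z.1 ∂H = ∫ u, f u * n u ∂H.fst :=
        (integral_map measurable_fst.aemeasurable hfn.aestronglyMeasurable).symm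
      have h2 : ∫ z, f z.2 * n z.2 ∂H = ∫ u, f u * n u ∂H.snd :=
        (integral_map measurable_snd.aemeasurable hfn.aestronglyMeasurable).symm
      have hi1 : Integrable (fun u => f u * n u) H.fst :=
        (hfi measurable_id (hin.mono_measure hH1') :)
      have hi2 : Integrable (fun u => f u * n u) H.snd :=
        (hfi measurable_id (hin.mono_measure hH2') :)
      rw [h1, h2, ← integral_add_measure hi1 hi2, ← integral_add_measure hIK (hi1.add_measure hi2),
        hKadd]
    have hGint : ∫ z, (f z.1 - f z.2) * (n z.2 - n z.1) ∂H = ∫ z, (f z.1 - f z.2) ∂G := by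
      rw [hH, integral_withDensity_eq_integral_smul hwm]
      refine integral_congr_ae ?_
      filter_upwards [hmem] with z hz
      have hpos : 0 < n z.2 - n z.1 := by linarith [hz.1, hz.2.1, hz.2.2]
      rw [NNReal.smul_def, hw, Real.coe_toNNReal _ (inv_pos.2 hpos).le, smul_eq_mul]
      field_simp
    have hexp : ∫ z, (f z.1 - f z.2) * (n z.2 - n z.1) ∂H
        = ∫ z, f z.1 * n z.2 ∂H - ∫ z, f z.1 * n z.1 ∂H
          - (∫ z, f z.2 * n z.2 ∂H - ∫ z, f z.2 * n z.1 ∂H) := by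
      rw [← integral_sub hI12 hI11, ← integral_sub hI22 hI21]
      refine Eq.trans ?_ (integral_sub (hI12.sub hI11) (hI22.sub hI21))
      congr 1
      ext z
      ring
    have hGf : ∫ z, (f z.1 - f z.2) ∂G = μ.real B - ν.real B := by
      rw [integral_sub (by simpa using hfi measurable_fst (integrable_const (1 : ℝ)))
        (by simpa using hfi measurable_snd (integrable_const (1 : ℝ)))]
      have h1 : ∫ z, f z.1 ∂G = μ.real B := by
        rw [← hG1, ← integral_indicator_one hB, Measure.fst]
        exact (integral_map measurable_fst.aemeasurable hfm.aestronglyMeasurable).symm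
      have h2 : ∫ z, f z.2 ∂G = ν.real B := by
        rw [← hG2, ← integral_indicator_one hB, Measure.snd]
        exact (integral_map measurable_snd.aemeasurable hfm.aestronglyMeasurable).symm
      rw [h1, h2]
    have hBn : ∫ u in B, n u ∂unitLaw = ∫ u, f u * n u ∂unitLaw :=
      hset unitLaw n id measurable_id
    have hBd := hdiff B hB
    rw [integral_sub him.integrableOn hin.integrableOn] at hBd
    linarith

end Exchange

/-- The coupling lemma needs Borel functions on the whole line; truncating to (0, 1) removes the
default values of the quantile and changes nothing almost everywhere for `unitLaw`. -/
theorem measurable_indicator_quantile (ρ : Measure ℝ) :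
    Measurable ((Ioo (0 : ℝ) 1).indicator (quantile (cdf ρ))) := by
  refine measurable_of_Iic fun x => ?_
  have : (Ioo (0 : ℝ) 1).indicator (quantile (cdf ρ)) ⁻¹' Iic x
      = (Ioo 0 1 ∩ Iic (cdf ρ x)) ∪ ((Ioo 0 1)ᶜ ∩ {_t | 0 ≤ x}) := by
    ext t
    by_cases ht : t ∈ Ioo (0 : ℝ) 1
    · simp only [mem_preimage, indicator_of_mem ht, mem_Iic, quantile_le_iff ρ ht, mem_union,
        mem_inter_iff, ht, true_and, mem_compl_iff, not_true_eq_false, false_and, or_false]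
    · simp only [mem_preimage, indicator_of_notMem ht, mem_Iic, mem_union,
        mem_inter_iff, ht, true_and, mem_compl_iff, not_false_eq_true, false_and, false_or,
        mem_ofPred_eq]
  rw [this]
  exact (measurableSet_Ioo.inter measurableSet_Iic).union
    (measurableSet_Ioo.compl.inter (MeasurableSet.const _))

/-- Strassen's theorem on the line, with the convex order expressed by superquantiles. -/
theorem exists_martingale_coupling {μ ν : Measure ℝ} [IsProbabilityMeasure μ]
    [IsProbabilityMeasure ν] (hμ : Integrable id μ) (hν : Integrable id ν)
    (hmean : ∫ x, x ∂μ = ∫ x, x ∂ν)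
    (hle : ∀ a ∈ Ioo (0 : ℝ) 1,
      ∫ t in a..1, quantile (cdf μ) t ≤ ∫ t in a..1, quantile (cdf ν) t) :
    ∃ ρ : Measure (ℝ × ℝ), ρ.fst = μ ∧ ρ.snd = ν ∧
      ∀ B, MeasurableSet B → ∫ z in Prod.fst ⁻¹' B, z.2 ∂ρ = ∫ x in B, x ∂μ := by
  have hae : ∀ σ : Measure ℝ, (Ioo (0 : ℝ) 1).indicator (quantile (cdf σ))
      =ᵐ[unitLaw] quantile (cdf σ) := fun σ => by
    filter_upwards [ae_unitLaw_mem] with t ht using indicator_of_mem ht _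
  have hmap : ∀ σ : Measure ℝ, IsProbabilityMeasure σ →
      unitLaw.map ((Ioo (0 : ℝ) 1).indicator (quantile (cdf σ))) = σ := fun σ _ => by
    rw [Measure.map_congr (hae σ), map_quantile]
  have hmean' : ∀ σ : Measure ℝ, IsProbabilityMeasure σ →
      ∫ t, (Ioo (0 : ℝ) 1).indicator (quantile (cdf σ)) t ∂unitLaw = ∫ x, x ∂σ := fun σ _ => by
    rw [integral_congr_ae (hae σ)]
    exact integral_comp_quantile σ measurable_id
  have htail : ∀ σ : Measure ℝ, ∀ a ∈ Ioo (0 : ℝ) 1,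
      ∫ t in Ioi a, (Ioo (0 : ℝ) 1).indicator (quantile (cdf σ)) t ∂unitLaw
        = ∫ t in a..1, quantile (cdf σ) t := fun σ a ha => by
    rw [intervalIntegral_eq_unitLaw ha.1.le ha.2.le]
    exact integral_congr_ae (ae_restrict_of_ae (hae σ))
  set m := (Ioo (0 : ℝ) 1).indicator (quantile (cdf μ)) with hm
  set n := (Ioo (0 : ℝ) 1).indicator (quantile (cdf ν)) with hn
  have hmm : Measurable m := measurable_indicator_quantile μ
  have hnm : Measurable n := measurable_indicator_quantile ν
  obtain ⟨ρ, h1, h2, h3⟩ := exists_uniform_martingale_coupling hmm hnm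
    ((quantile_monotoneOn μ).congr fun t ht => (indicator_of_mem ht _).symm)
    ((integrable_quantile hμ).congr (hae μ).symm) ((integrable_quantile hν).congr (hae ν).symm)
    (by rw [hmean' μ inferInstance, hmean' ν inferInstance, hmean])
    (fun x => by
      rcases le_or_gt x 0 with hx | hx
      · have hfull : unitLaw.restrict (Ioi x) = unitLaw := by
          refine Measure.restrict_eq_self_of_ae_mem ?_
          filter_upwards [ae_unitLaw_mem] with t ht using hx.trans_lt ht.1
        rw [hfull, hmean' μ inferInstance, hmean' ν inferInstance, hmean]
      rcases lt_or_ge x 1 with hx1 | hx1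
      · rw [htail μ x ⟨hx, hx1⟩, htail ν x ⟨hx, hx1⟩]
        exact hle x ⟨hx, hx1⟩
      · have hnull : unitLaw.restrict (Ioi x) = 0 := by
          rw [Measure.restrict_eq_zero, ← compl_Iic, ← mem_ae_iff]
          filter_upwards [ae_unitLaw_mem] with t ht using ht.2.le.trans hx1
        simp [hnull])
  have hz : Measurable (Prod.map m n) := hmm.prodMap hnm
  refine ⟨ρ.map (Prod.map m n), ?_, ?_, fun B hB => ?_⟩
  · rw [Measure.fst, Measure.map_map measurable_fst hz, Prod.map_fst',
      ← Measure.map_map hmm measurable_fst]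
    exact (congrArg (Measure.map m) h1).trans (hmap μ inferInstance)
  · rw [Measure.snd, Measure.map_map measurable_snd hz, Prod.map_snd',
      ← Measure.map_map hnm measurable_snd]
    exact (congrArg (Measure.map n) h2).trans (hmap ν inferInstance)
  · rw [setIntegral_map (measurable_fst hB) measurable_snd.aestronglyMeasurable hz.aemeasurable]
    refine (h3 (m ⁻¹' B) (hmm hB)).trans ?_
    have h4 := setIntegral_map (μ := unitLaw) hB
      (measurable_id (α := ℝ)).aestronglyMeasurable hmm.aemeasurable
    rw [hm, hmap μ inferInstance] at h4
    exact h4.symm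

/-- A function `h` of a random element whose law is dominated by `ν` in the convex order is a
conditional expectation, given that element, of a random variable with law `ν`. -/
theorem exists_coupling_condMean {E : Type*} [MeasurableSpace E] (Q : Measure E)
    [IsProbabilityMeasure Q] {h : E → ℝ} (hh : Measurable h) (hhi : Integrable h Q)
    {ν : Measure ℝ} [IsProbabilityMeasure ν] (hν : Integrable id ν)
    (hmean : ∫ x, h x ∂Q = ∫ y, y ∂ν)
    (hle : ∀ a ∈ Ioo (0 : ℝ) 1,
      ∫ t in a..1, quantile (cdf (Q.map h)) t ≤ ∫ t in a..1, quantile (cdf ν) t) :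
    ∃ π : Measure (E × ℝ), π.fst = Q ∧ π.snd = ν ∧
      ∀ A, MeasurableSet A → ∫ z in Prod.fst ⁻¹' A, z.2 ∂π = ∫ x in A, h x ∂Q := by
  have := Measure.isProbabilityMeasure_map (μ := Q) hh.aemeasurable
  obtain ⟨ρ, h1, h2, h3⟩ := exists_martingale_coupling (integrable_id_map hh hhi) hν
    (by rw [← hmean]; exact integral_map hh.aemeasurable measurable_id.aestronglyMeasurable) hle
  have hρ : IsProbabilityMeasure ρ := ⟨by rw [← Measure.fst_univ, h1]; exact measure_univ⟩
  set κ := ρ.condKernel with hκ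
  have hdis : Q.map h ⊗ₘ κ = ρ := by rw [← h1]; exact ρ.disintegrate κ
  have hρi : Integrable (fun z : ℝ × ℝ => z.2) ρ := by
    rw [← h2, Measure.snd] at hν
    exact (integrable_map_measure aestronglyMeasurable_id measurable_snd.aemeasurable).1 hν
  have hcond : ∀ᵐ s ∂(Q.map h), ∫ y, y ∂κ s = s := by
    have hi : Integrable (fun s => ∫ y, y ∂κ s) (Q.map h) := by
      rw [← hdis] at hρi
      exact MeasureTheory.Integrable.integral_compProd hρi
    refine hi.ae_eq_of_forall_setIntegral_eq _ _ (integrable_id_map hh hhi) fun B hB _ => ?_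
    have h4 := h3 B hB
    rw [← prod_univ, ← hdis, Measure.setIntegral_compProd hB MeasurableSet.univ
      (by rw [hdis]; exact hρi.integrableOn)] at h4
    simpa using h4
  -- Draw x from `Q`, then y from the martingale kernel at h(x). Since y depends on x only through
  -- h(x), its mean given all of x is still h(x).
  set π := Q ⊗ₘ κ.comap h hh with hπ
  have hmap : π.map (Prod.map h id) = ρ := by
    ext S hS
    rw [Measure.map_apply (hh.prodMap measurable_id) hS, hπ,
      Measure.compProd_apply ((hh.prodMap measurable_id) hS), ← hdis, Measure.compProd_apply hS,
      lintegral_map (Kernel.measurable_kernel_prodMk_left hS) hh]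
    rfl
  have hsnd : π.snd = ν := by
    rw [← h2, ← hmap, Measure.snd, Measure.snd, Measure.map_map measurable_snd
      (hh.prodMap measurable_id), Prod.map_snd', Function.id_comp]
  refine ⟨π, Measure.fst_compProd Q _, hsnd, fun A hA => ?_⟩
  have hπi : Integrable (fun z : E × ℝ => z.2) π := by
    rw [← hsnd, Measure.snd] at hν
    exact (integrable_map_measure aestronglyMeasurable_id measurable_snd.aemeasurable).1 hν
  rw [← prod_univ, Measure.setIntegral_compProd hA MeasurableSet.univ hπi.integrableOn]
  refine integral_congr_ae (ae_restrict_of_ae ?_)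
  filter_upwards [ae_of_ae_map hh.aemeasurable hcond] with x hx
  rw [Measure.restrict_univ, Kernel.comap_apply, hx]

/-! ### Centred variables and linear indices -/

section Basic

theorem linIndex_smul {Ω : Type*} {p : ℕ} {A : Ω → EuclideanSpace ℝ (Fin p)} (l : ℝ) (b : EuclideanSpace ℝ (Fin p)) :
    linIndex A (l • b) = fun ω => l * linIndex A b ω := by
  ext ω
  exact real_inner_smul_right _ _ _

theorem linIndex_add {Ω : Type*} {p : ℕ} {A : Ω → EuclideanSpace ℝ (Fin p)} (b d : EuclideanSpace ℝ (Fin p)) :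
    linIndex A (b + d) = fun ω => linIndex A b ω + linIndex A d ω := by
  ext ω
  exact inner_add_right _ _ _

variable {Ω : Type*} [MeasurableSpace Ω] {P : Measure Ω}

theorem measurable_centered {E : Type*} [NormedAddCommGroup E] [NormedSpace ℝ E]
    [MeasurableSpace E] [BorelSpace E] [SecondCountableTopology E] {A : Ω → E}
    (hA : Measurable A) : Measurable (centered P A) :=
  hA.sub_const _

theorem integral_eq_of_map_eq {Ω' : Type*} [MeasurableSpace Ω'] {P' : Measure Ω'}
    {E : Type*} [NormedAddCommGroup E] [NormedSpace ℝ E]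
    [MeasurableSpace E] [BorelSpace E] [SecondCountableTopology E] {A : Ω → E} {A' : Ω' → E}
    (hA : Measurable A) (hA' : Measurable A') (h : P'.map A' = P.map A) :
    ∫ ω, A' ω ∂P' = ∫ ω, A ω ∂P := by
  have h1 := integral_map (μ := P') hA'.aemeasurable aestronglyMeasurable_id
  have h2 := integral_map (μ := P) hA.aemeasurable aestronglyMeasurable_id
  rw [h] at h1
  exact h1.symm.trans h2

theorem map_centered {Ω' : Type*} [MeasurableSpace Ω'] {P' : Measure Ω'}
    {E : Type*} [NormedAddCommGroup E] [NormedSpace ℝ E]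
    [MeasurableSpace E] [BorelSpace E] [SecondCountableTopology E] {A : Ω → E} {A' : Ω' → E}
    (hA : Measurable A) (hA' : Measurable A') (h : P'.map A' = P.map A) :
    P'.map (centered P' A') = P.map (centered P A) := by
  have hm := integral_eq_of_map_eq hA hA' h
  have hs : Measurable fun x : E => x - ∫ ω, A ω ∂P := measurable_id.sub_const _
  have h1 : P.map (centered P A) = (P.map A).map fun x : E => x - ∫ ω, A ω ∂P := by
    rw [Measure.map_map hs hA]; rfl
  have h2 : P'.map (centered P' A') = (P'.map A').map fun x : E => x - ∫ ω, A ω ∂P := by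
    rw [Measure.map_map hs hA', ← hm]; rfl
  rw [h1, h2, h]

theorem integrable_centered [IsFiniteMeasure P] {E : Type*} [NormedAddCommGroup E]
    [NormedSpace ℝ E] {A : Ω → E} (hA : Integrable A P) : Integrable (centered P A) P :=
  hA.sub (integrable_const _)

theorem integral_centered [IsProbabilityMeasure P] {E : Type*} [NormedAddCommGroup E]
    [NormedSpace ℝ E] [CompleteSpace E] {A : Ω → E} (hA : Integrable A P) :
    ∫ ω, centered P A ω ∂P = 0 := by
  simp [centered, integral_sub hA (integrable_const _)]

variable {p : ℕ} {A : Ω → EuclideanSpace ℝ (Fin p)}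

theorem measurable_linIndex (hA : Measurable A) (b : EuclideanSpace ℝ (Fin p)) :
    Measurable (linIndex A b) :=
  hA.inner_const

theorem integrable_linIndex (hA : Integrable A P) (b : EuclideanSpace ℝ (Fin p)) :
    Integrable (linIndex A b) P :=
  hA.inner_const b

theorem integral_linIndex_centered [IsProbabilityMeasure P] (hA : Integrable A P)
    (b : EuclideanSpace ℝ (Fin p)) : ∫ ω, linIndex (centered P A) b ω ∂P = 0 := by
  have h := integral_inner (𝕜 := ℝ) (integrable_centered hA) b
  rw [integral_centered hA, inner_zero_right] at h
  rw [← h]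
  exact integral_congr_ae (ae_of_all _ fun ω => real_inner_comm _ _)

theorem map_linIndex {Ω' : Type*} [MeasurableSpace Ω'] {P' : Measure Ω'}
    {A' : Ω' → EuclideanSpace ℝ (Fin p)} (hA : Measurable A) (hA' : Measurable A')
    (h : P'.map A' = P.map A) (b : EuclideanSpace ℝ (Fin p)) :
    P'.map (linIndex A' b) = P.map (linIndex A b) := by
  have hs : Measurable fun x : EuclideanSpace ℝ (Fin p) => (inner ℝ x b : ℝ) :=
    measurable_id.inner_const
  have h1 : P.map (linIndex A b) = (P.map A).map fun x => (inner ℝ x b : ℝ) := by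
    rw [Measure.map_map hs hA]; rfl
  have h2 : P'.map (linIndex A' b) = (P'.map A').map fun x => (inner ℝ x b : ℝ) := by
    rw [Measure.map_map hs hA']; rfl
  rw [h1, h2, h]

/-- If the variance matrix is nonsingular then no linear index is degenerate. -/
theorem linIndex_centered_ne_zero [IsProbabilityMeasure P] (hA2 : MemLp A 2 P)
    (hV : (varianceMatrix P A).det ≠ 0) {q : EuclideanSpace ℝ (Fin p)} (hq : q ≠ 0) :
    ¬ linIndex (centered P A) q =ᵐ[P] 0 := by
  intro h0
  have hc : ∀ i, MemLp (fun ω => A ω i) 2 P := fun i =>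
    (EuclideanSpace.proj i : EuclideanSpace ℝ (Fin p) →L[ℝ] ℝ).comp_memLp' hA2
  have hk : ∃ k : ℝ, (fun ω => ∑ j, A ω j * q j) =ᵐ[P] fun _ => k := by
    refine ⟨inner ℝ (∫ ω, A ω ∂P) q, ?_⟩
    filter_upwards [h0] with ω hω
    have h1 : (inner ℝ (A ω) q : ℝ) = inner ℝ (∫ ω, A ω ∂P) q :=
      sub_eq_zero.1 ((inner_sub_left (𝕜 := ℝ) _ _ _).symm.trans hω)
    rw [← h1, PiLp.inner_apply]
    exact Finset.sum_congr rfl fun j _ => by simp [mul_comm]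
  obtain ⟨k, hk⟩ := hk
  refine hq ?_
  -- Entry i of V(A)q is Cov(Aᵢ, A'q), which vanishes because A'q is almost surely constant.
  have h2 : (varianceMatrix P A).mulVec (fun j => q j) = 0 := by
    ext i
    have h3 : (varianceMatrix P A).mulVec (fun j => q j) i
        = covariance (fun ω => A ω i) (fun ω => ∑ j, A ω j * q j) P := by
      rw [covariance_fun_sum_right (fun j => (hc j).mul_const (q j)) (hc i)]
      simp only [covariance_mul_const_right]
      rfl
    rw [h3, Pi.zero_apply, covariance]
    refine integral_eq_zero_of_ae ?_
    have hint : ∫ ω, ∑ j, A ω j * q j ∂P = k := by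
      rw [integral_congr_ae hk]; simp
    filter_upwards [hk] with ω hω
    rw [hint, hω, sub_self, mul_zero, Pi.zero_apply]
  have h4 := Matrix.eq_zero_of_mulVec_eq_zero hV h2
  ext j
  exact congrFun h4 j

end Basic

/-! ### The identified and regularized sets -/

section Sets

variable {Ω : Type*} [MeasurableSpace Ω] {P : Measure Ω} {p : ℕ}
  {X : Ω → EuclideanSpace ℝ (Fin p)} {Y : Ω → ℝ}

/-- Conditional Jensen for x ↦ (x - c)⁺, done by hand: the event {X₀'b > c} is measurable with
respect to X₀, so X₀'b may be replaced by Y₀ when integrating over it. Taking c to be the quantile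
of Y₀ suffices. -/
theorem superquantile_le_of_mem_identifiedSet (hX : Measurable X) (hY : Measurable Y)
    (hXi : Integrable X P) (hYi : Integrable Y P) {b : EuclideanSpace ℝ (Fin p)}
    (hb : b ∈ identifiedSet P X Y) {a : ℝ} (ha : a ∈ Ioo (0 : ℝ) 1) :
    superquantile P (linIndex (centered P X) b) a ≤ superquantile P (centered P Y) a := by
  obtain ⟨Ω', _, P', X', Y', hP', hX', hY', hlX, hlY, hc⟩ := hb
  have hX0 := measurable_centered (P := P') hX'
  have hY0 := measurable_centered (P := P') hY'
  have hXi' : Integrable X' P' := by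
    have := (integrable_map_measure aestronglyMeasurable_id hX.aemeasurable).2 hXi
    rw [← hlX] at this
    exact (integrable_map_measure aestronglyMeasurable_id hX'.aemeasurable).1 this
  have hYi' : Integrable Y' P' := by
    have := (integrable_map_measure aestronglyMeasurable_id hY.aemeasurable).2 hYi
    rw [← hlY] at this
    exact (integrable_map_measure aestronglyMeasurable_id hY'.aemeasurable).1 this
  have hXi0 := integrable_linIndex (integrable_centered hXi') b
  have hYi0 := integrable_centered hYi'
  have hXm := measurable_linIndex hX0 b
  rw [← superquantile_congr (measurable_linIndex (measurable_centered hX) b) hXm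
      (map_linIndex (measurable_centered hX) hX0 (map_centered hX hX' hlX) b),
    ← superquantile_congr (measurable_centered hY) hY0 (map_centered hY hY' hlY)]
  refine superquantile_le_of_excess_le hXm hXi0 hY0 hYi0 ha ?_
  set c := quantile (cdfOf P' (centered P' Y')) a
  set s : Set Ω' := {ω | c < linIndex (centered P' X') b ω} with hs
  have hs' : MeasurableSet[MeasurableSpace.comap (centered P' X') inferInstance] s :=
    ⟨{x | c < inner ℝ x b}, measurableSet_lt measurable_const measurable_id.inner_const, rfl⟩
  have hsm : MeasurableSet s := measurableSet_lt measurable_const hXm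
  have hset : ∫ ω in s, linIndex (centered P' X') b ω ∂P' = ∫ ω in s, centered P' Y' ω ∂P' := by
    rw [← setIntegral_condExp hX0.comap_le hYi0 hs']
    exact integral_congr_ae (ae_restrict_of_ae hc.symm)
  calc ∫ ω, max (linIndex (centered P' X') b ω - c) 0 ∂P'
      = ∫ ω in s, (linIndex (centered P' X') b ω - c) ∂P' := by
        rw [← integral_indicator hsm]
        congr 1
        ext ω
        by_cases hω : ω ∈ s
        · rw [indicator_of_mem hω]
          exact max_eq_left (sub_nonneg.2 (le_of_lt hω))
        · rw [indicator_of_notMem hω]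
          exact max_eq_right (sub_nonpos.2 (not_lt.1 hω))
    _ = ∫ ω in s, (centered P' Y' ω - c) ∂P' := by
        rw [integral_sub hXi0.integrableOn (integrable_const c).integrableOn, hset,
          ← integral_sub hYi0.integrableOn (integrable_const c).integrableOn]
    _ ≤ ∫ ω in s, max (centered P' Y' ω - c) 0 ∂P' :=
        integral_mono (hYi0.sub (integrable_const c)).integrableOn
          (integrable_excess hYi0 c).integrableOn fun ω => le_max_left _ _
    _ ≤ ∫ ω, max (centered P' Y' ω - c) 0 ∂P' :=
        setIntegral_le_integral (integrable_excess hYi0 c) (ae_of_all _ fun ω => le_max_right _ _)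

variable [IsProbabilityMeasure P]

theorem superquantile_linIndex_smul (hX : Measurable X) (hXi : Integrable X P)
    {a : ℝ} (ha : a ∈ Ioo (0 : ℝ) 1) {l : ℝ} (hl : 0 ≤ l) (b : EuclideanSpace ℝ (Fin p)) :
    superquantile P (linIndex (centered P X) (l • b)) a
      = l * superquantile P (linIndex (centered P X) b) a := by
  rw [linIndex_smul]
  exact superquantile_mul (measurable_linIndex (measurable_centered hX) b)
    (integrable_linIndex (integrable_centered hXi) b) ha hl

theorem convexOn_superquantile_linIndex (hX : Measurable X) (hXi : Integrable X P)
    {a : ℝ} (ha : a ∈ Ioo (0 : ℝ) 1) :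
    ConvexOn ℝ univ fun b => superquantile P (linIndex (centered P X) b) a := by
  refine ⟨convex_univ, fun b _ d _ s t hs ht _ => ?_⟩
  have hm := measurable_linIndex (measurable_centered (P := P) hX)
  have hi := integrable_linIndex (integrable_centered hXi)
  rw [smul_eq_mul, smul_eq_mul, ← superquantile_linIndex_smul hX hXi ha hs,
    ← superquantile_linIndex_smul hX hXi ha ht]
  beta_reduce
  rw [linIndex_add]
  exact superquantile_add_le (hm _) (hi _) (hm _) (hi _) ha

theorem continuous_superquantile_linIndex (hX : Measurable X) (hXi : Integrable X P)
    {a : ℝ} (ha : a ∈ Ioo (0 : ℝ) 1) :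
    Continuous fun b => superquantile P (linIndex (centered P X) b) a :=
  continuousOn_univ.1 ((convexOn_superquantile_linIndex hX hXi ha).continuousOn isOpen_univ)

theorem superquantile_linIndex_pos (hX : Measurable X) (hX2 : MemLp X 2 P)
    (hV : (varianceMatrix P X).det ≠ 0) {a : ℝ} (ha : a ∈ Ioo (0 : ℝ) 1)
    {q : EuclideanSpace ℝ (Fin p)} (hq : q ≠ 0) :
    0 < superquantile P (linIndex (centered P X) q) a :=
  have hXi : Integrable X P := hX2.integrable one_le_two
  superquantile_pos (measurable_linIndex (measurable_centered hX) q)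
    (integrable_linIndex (integrable_centered hXi) q) (integral_linIndex_centered hXi q) ha
    (linIndex_centered_ne_zero hX2 hV hq)

/-- The regularized set is cut out by superquantile inequalities. -/
theorem regularizedSet_eq (hp : 1 ≤ p) (hX : Measurable X) (hY : Measurable Y)
    (hYi : Integrable Y P) (hX2 : MemLp X 2 P) (hV : (varianceMatrix P X).det ≠ 0)
    {ε : ℝ} (hε : 0 < ε) (hε2 : ε < 1 / 2) :
    regularizedSet P X Y ε = {b | ∀ a ∈ Icc ε (1 - ε),
      superquantile P (linIndex (centered P X) b) a ≤ superquantile P (centered P Y) a} := by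
  have hXi : Integrable X P := hX2.integrable one_le_two
  have hI : ∀ a ∈ Icc ε (1 - ε), a ∈ Ioo (0 : ℝ) 1 := fun a ha =>
    ⟨hε.trans_le ha.1, ha.2.trans_lt (by linarith)⟩
  have hY0 : ∀ a ∈ Icc ε (1 - ε), 0 ≤ superquantile P (centered P Y) a := fun a ha =>
    superquantile_nonneg (measurable_centered hY) (integrable_centered hYi)
      (integral_centered hYi) (hI a ha)
  have hle : ∀ q : EuclideanSpace ℝ (Fin p), ‖q‖ = 1 → ∀ l : ℝ, 0 ≤ l →
      (l ≤ Seps ε (cdfOf P (centered P Y)) (cdfOf P (linIndex (centered P X) q)) ↔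
        ∀ a ∈ Icc ε (1 - ε), superquantile P (linIndex (centered P X) (l • q)) a
          ≤ superquantile P (centered P Y) a) := fun q hq l hl => by
    have hq0 : q ≠ 0 := fun h => by simp [h] at hq
    have hpos := fun a ha => superquantile_linIndex_pos hX hX2 hV (hI a ha) hq0
    -- Only lower bounds of the ratios enter, so attainment of the minimum is not needed; 0 bounds
    -- them below.
    rw [Seps, le_csInf_iff ?_ ((nonempty_Icc.2 (by linarith)).image _), forall_mem_image]
    · refine forall₂_congr fun a ha => ?_
      rw [superquantile_linIndex_smul hX hXi (hI a ha) hl]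
      exact le_div_iff₀ (hpos a ha)
    · refine ⟨0, ?_⟩
      rintro _ ⟨a, ha, rfl⟩
      exact div_nonneg (hY0 a ha) (hpos a ha).le
  ext b
  constructor
  · rintro ⟨q, hq, l, hl, hls, rfl⟩
    exact (hle q hq l hl).1 hls
  · intro hb
    -- For b = 0 any unit vector serves, and one exists because p ≥ 1.
    have key : ∃ q : EuclideanSpace ℝ (Fin p), ‖q‖ = 1 ∧ b = ‖b‖ • q := by
      by_cases h0 : b = 0
      · refine ⟨EuclideanSpace.single ⟨0, hp⟩ 1, by simp, by simp [h0]⟩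
      · have hb0 : ‖b‖ ≠ 0 := norm_ne_zero_iff.2 h0
        refine ⟨‖b‖⁻¹ • b, ?_, ?_⟩
        · rw [norm_smul, norm_inv, norm_norm, inv_mul_cancel₀ hb0]
        · rw [smul_smul, mul_inv_cancel₀ hb0, one_smul]
    obtain ⟨q, hq, hbq⟩ := key
    refine ⟨q, hq, ‖b‖, norm_nonneg b, (hle q hq _ (norm_nonneg b)).2 ?_, hbq⟩
    rwa [← hbq]

/-- The level 1/2 belongs to every [ε, 1 - ε], and that one inequality already bounds b: the
superquantile of X₀'q has a positive minimum over the compact unit sphere and is positively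
homogeneous. -/
theorem isBounded_regularizedSet (hp : 1 ≤ p) (hX : Measurable X) (hY : Measurable Y)
    (hYi : Integrable Y P) (hX2 : MemLp X 2 P) (hV : (varianceMatrix P X).det ≠ 0)
    {ε : ℝ} (hε : 0 < ε) (hε2 : ε < 1 / 2) :
    ∃ M : ℝ, ∀ b ∈ regularizedSet P X Y ε, ‖b‖ ≤ M := by
  have hXi : Integrable X P := hX2.integrable one_le_two
  have ha : (1 / 2 : ℝ) ∈ Ioo (0 : ℝ) 1 := by norm_num
  have hne : (Metric.sphere (0 : EuclideanSpace ℝ (Fin p)) 1).Nonempty :=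
    ⟨EuclideanSpace.single ⟨0, hp⟩ 1, by simp⟩
  obtain ⟨q₀, hq₀, hmin⟩ := (isCompact_sphere (0 : EuclideanSpace ℝ (Fin p)) 1).exists_isMinOn hne
    (continuous_superquantile_linIndex (P := P) hX hXi ha).continuousOn
  have hpos : 0 < superquantile P (linIndex (centered P X) q₀) (1 / 2) :=
    superquantile_linIndex_pos hX hX2 hV ha (fun h => by simp [h] at hq₀)
  refine ⟨superquantile P (centered P Y) (1 / 2)
    / superquantile P (linIndex (centered P X) q₀) (1 / 2), fun b hb => ?_⟩
  have hb' := hb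
  rw [regularizedSet_eq hp hX hY hYi hX2 hV hε hε2] at hb'
  obtain ⟨q, hq, l, hl, -, rfl⟩ := hb
  have h1 := hb' (1 / 2) ⟨hε2.le, by linarith⟩
  rw [superquantile_linIndex_smul hX hXi ha hl] at h1
  rw [norm_smul, hq, mul_one, Real.norm_of_nonneg hl, le_div_iff₀ hpos]
  have h2 : superquantile P (linIndex (centered P X) q₀) (1 / 2)
      ≤ superquantile P (linIndex (centered P X) q) (1 / 2) := hmin (by simpa using hq)
  exact (mul_le_mul_of_nonneg_left h2 hl).trans h1

/-- The sufficiency half of the convex order criterion: couple the law of X with that of Y₀ so that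
the conditional mean given x is (x - E(X))'b, then add E(Y) back to the second coordinate. -/
theorem mem_identifiedSet_of_superquantile_le (hX : Measurable X) (hY : Measurable Y)
    (hXi : Integrable X P) (hYi : Integrable Y P) {b : EuclideanSpace ℝ (Fin p)}
    (hb : ∀ a ∈ Ioo (0 : ℝ) 1, superquantile P (linIndex (centered P X) b) a
      ≤ superquantile P (centered P Y) a) :
    b ∈ identifiedSet P X Y := by
  have hX0 := measurable_centered (P := P) hX
  have hY0 := measurable_centered (P := P) hY
  have hYi0 := integrable_centered hYi
  have := Measure.isProbabilityMeasure_map (μ := P) hX.aemeasurable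
  have := Measure.isProbabilityMeasure_map (μ := P) hY0.aemeasurable
  set k := ∫ ω, X ω ∂P with hk
  set h : EuclideanSpace ℝ (Fin p) → ℝ := fun x => inner ℝ (x - k) b with hh
  have hhm : Measurable h := (measurable_id.sub_const k).inner_const
  have hmap : (P.map X).map h = P.map (linIndex (centered P X) b) := by
    rw [Measure.map_map hhm hX]; rfl
  have hhi : Integrable h (P.map X) :=
    (integrable_map_measure hhm.aestronglyMeasurable hX.aemeasurable).2
      (integrable_linIndex (integrable_centered hXi) b)
  obtain ⟨π, h1, h2, h3⟩ := exists_coupling_condMean (P.map X) hhm hhi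
    (integrable_id_map hY0 hYi0)
    (by
      rw [integral_map hX.aemeasurable hhm.aestronglyMeasurable]
      refine ((integral_linIndex_centered hXi b).trans (integral_centered hYi).symm).trans ?_
      exact (integral_map hY0.aemeasurable
        (measurable_id (α := ℝ)).aestronglyMeasurable).symm)
    (fun a ha => by
      rw [hmap, ← cdfOf_eq_cdf_map (measurable_linIndex hX0 b), ← cdfOf_eq_cdf_map hY0]
      exact hb a ha)
  have hπ : IsProbabilityMeasure π := ⟨by rw [← Measure.fst_univ, h1]; exact measure_univ⟩
  set e := ∫ ω, Y ω ∂P with he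
  have hYm : Measurable fun z : EuclideanSpace ℝ (Fin p) × ℝ => z.2 + e :=
    measurable_snd.add_const e
  have hYlaw : π.map (fun z => z.2 + e) = P.map Y := by
    have hadd : Measurable fun y : ℝ => y + e := measurable_id.add_const e
    have h4 : π.map (fun z => z.2 + e) = π.snd.map fun y => y + e := by
      rw [Measure.snd, Measure.map_map hadd measurable_snd]; rfl
    rw [h4, h2, Measure.map_map hadd hY0]
    congr 1
    ext ω
    simp [centered, he]
  have hkint : ∫ z, z.1 ∂π = k := integral_eq_of_map_eq hX measurable_fst h1
  have heint : ∫ z, (z.2 + e) ∂π = e := integral_eq_of_map_eq hY hYm hYlaw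
  have hcX : centered π Prod.fst = fun z : EuclideanSpace ℝ (Fin p) × ℝ => z.1 - k := by
    ext1 z; rw [centered, hkint]
  have hcY : centered π (fun z : EuclideanSpace ℝ (Fin p) × ℝ => z.2 + e) = Prod.snd := by
    ext1 z; rw [centered, heint, add_sub_cancel_right]
  have hsi : Integrable (fun z : EuclideanSpace ℝ (Fin p) × ℝ => z.2) π := by
    have := integrable_id_map hY0 hYi0
    rw [← h2, Measure.snd] at this
    exact (integrable_map_measure aestronglyMeasurable_id measurable_snd.aemeasurable).1 this
  have hfi : Integrable (fun z : EuclideanSpace ℝ (Fin p) × ℝ => h z.1) π := by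
    rw [← h1, Measure.fst] at hhi
    exact (integrable_map_measure hhm.aestronglyMeasurable measurable_fst.aemeasurable).1 hhi
  refine ⟨EuclideanSpace ℝ (Fin p) × ℝ, inferInstance, π, Prod.fst, fun z => z.2 + e, hπ,
    measurable_fst, hYm, h1, hYlaw, ?_⟩
  rw [hcX, hcY]
  have hcm : Measurable fun z : EuclideanSpace ℝ (Fin p) × ℝ => z.1 - k :=
    measurable_fst.sub_const k
  symm
  refine ae_eq_condExp_of_forall_setIntegral_eq hcm.comap_le hsi
    (fun s _ _ => hfi.integrableOn) ?_ ?_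
  · rintro _ ⟨B, hB, rfl⟩ -
    have hB' : MeasurableSet ((fun x => x - k) ⁻¹' B) := measurable_id.sub_const k hB
    have h5 := h3 _ hB'
    rw [← h1, Measure.fst,
      setIntegral_map hB' hhm.aestronglyMeasurable measurable_fst.aemeasurable] at h5
    exact h5.symm
  · refine StronglyMeasurable.aestronglyMeasurable ?_
    refine Measurable.stronglyMeasurable ?_
    exact Measurable.comp (g := fun x : EuclideanSpace ℝ (Fin p) => (inner ℝ x b : ℝ))
      measurable_id.inner_const (comap_measurable _)

end Sets

/-! ### Tail comparison -/

section Tails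

variable {Ω : Type*} [MeasurableSpace Ω] {P : Measure Ω} [IsProbabilityMeasure P]

theorem exists_half_le_measure_abs_le (P : Measure Ω) [IsProbabilityMeasure P] (W : Ω → ℝ) :
    ∃ K : ℝ, 0 ≤ K ∧ 1 / 2 ≤ P (W ⁻¹' Icc (-K) K) := by
  have hmono : Monotone fun n : ℕ => W ⁻¹' Icc (-(n : ℝ)) n := fun i j hij => by
    have : (i : ℝ) ≤ j := by exact_mod_cast hij
    exact preimage_mono (Icc_subset_Icc (neg_le_neg this) this)
  have hU : ⋃ n : ℕ, W ⁻¹' Icc (-(n : ℝ)) n = univ := by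
    refine eq_univ_of_forall fun ω => mem_iUnion.2 ?_
    obtain ⟨n, hn⟩ := exists_nat_ge |W ω|
    exact ⟨n, abs_le.1 hn⟩
  have h := tendsto_measure_iUnion_atTop (μ := P) hmono
  rw [hU, measure_univ] at h
  obtain ⟨n, hn⟩ := (h.eventually (eventually_gt_nhds
    (show (1 / 2 : ℝ≥0∞) < 1 by rw [one_div]; exact ENNReal.one_half_lt_one))).exists
  exact ⟨n, n.cast_nonneg, hn.le⟩

/-- On {|W| ≤ K}, V > t + K forces Z > t. The form V - |W| ≤ Z covers both tails, with V = ±U and Z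
= ±Y₀. -/
theorem setLIntegral_condDistrib_le {V W Z : Ω → ℝ} (hV : Measurable V) (hW : Measurable W)
    (hZ : ∀ ω, V ω - |W ω| ≤ Z ω) (K t : ℝ) :
    ∫⁻ ω in W ⁻¹' Icc (-K) K, condDistrib V W P (W ω) (Ioi (t + K)) ∂P ≤ P {ω | t < Z ω} := by
  rw [setLIntegral_preimage_condDistrib hW hV.aemeasurable measurableSet_Ioi measurableSet_Icc]
  refine measure_mono fun ω hω => ?_
  have h1 : |W ω| ≤ K := abs_le.2 hω.1
  have h2 : t + K < V ω := hω.2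
  have h3 := hZ ω
  change t < Z ω
  linarith

theorem ThinnerTail.measure_pos {N V W Z : Ω → ℝ} (h : ThinnerTail P N V W)
    (hV : Measurable V) (hW : Measurable W) (hZ : ∀ ω, V ω - |W ω| ≤ Z ω) (t : ℝ) :
    0 < P {ω | t < Z ω} := by
  obtain ⟨K, -, hK⟩ := exists_half_le_measure_abs_le P W
  refine lt_of_lt_of_le ?_ (setLIntegral_condDistrib_le hV hW hZ K t)
  rw [pos_iff_ne_zero]
  intro h0
  have hm : Measurable fun ω => condDistrib V W P (W ω) (Ioi (t + K)) :=
    (Kernel.measurable_coe _ measurableSet_Ioi).comp hW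
  rw [lintegral_eq_zero_iff hm] at h0
  have h1 := ae_restrict_of_ae (s := W ⁻¹' Icc (-K) K)
    (ae_of_ae_map hW.aemeasurable (h.1 (t + K)))
  have h2 : ∀ᵐ ω ∂(P.restrict (W ⁻¹' Icc (-K) K)), False := by
    filter_upwards [h0, h1] with ω h3 h4 using h4.ne' h3
  rw [ae_iff] at h2
  simp only [not_false_eq_true, ofPred_true, Measure.restrict_apply_univ] at h2
  rw [h2] at hK
  simp at hK

/-- Conditioning on a bounded range of W of probability at least 1/2 costs a factor 2, which the
vanishing ratio of tails absorbs once it is below 1/2. -/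
theorem ThinnerTail.exists_measure_le {N V W Z : Ω → ℝ} (h : ThinnerTail P N V W)
    (hV : Measurable V) (hW : Measurable W) (hZ : ∀ ω, V ω - |W ω| ≤ Z ω) {c : ℝ} (hc : 0 < c) :
    ∃ t₀ : ℝ, ∀ t ≥ t₀, P {ω | c * t < N ω} ≤ P {ω | t < Z ω} := by
  obtain ⟨K, hK0, hK⟩ := exists_half_le_measure_abs_le P W
  obtain ⟨t₁, ht₁⟩ := eventually_atTop.1 ((h.2 (c / 2) (half_pos hc)).eventually
    (eventually_lt_nhds (show (0 : ℝ≥0∞) < 1 / 2 by simp)))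
  -- The halved constant c/2 absorbs the shift by K: for t ≥ K, (c/2)(t + K) ≤ ct.
  refine ⟨max t₁ K, fun t ht => ?_⟩
  have htK : K ≤ t := (le_max_right _ _).trans ht
  refine le_trans ?_ (setLIntegral_condDistrib_le hV hW hZ K t)
  have h1 := ae_lt_of_essSup_lt (ht₁ (t + K) (by linarith [(le_max_left t₁ K).trans ht]))
  set x := P {ω | c / 2 * (t + K) < N ω} with hx
  have h2 : ∀ᵐ ω ∂P, 2 * x ≤ condDistrib V W P (W ω) (Ioi (t + K)) := by
    filter_upwards [ae_of_ae_map hW.aemeasurable h1,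
      ae_of_ae_map hW.aemeasurable (h.1 (t + K))] with ω h3 h4
    have h5 := (ENNReal.div_lt_iff (Or.inl h4.ne') (Or.inl (measure_ne_top _ _))).1 h3
    calc 2 * x ≤ 2 * (1 / 2 * condDistrib V W P (W ω) (Ioi (t + K))) := by gcongr
      _ = _ := by
        rw [← mul_assoc, one_div, ENNReal.mul_inv_cancel two_ne_zero ENNReal.ofNat_ne_top, one_mul]
  calc P {ω | c * t < N ω} ≤ x := by
        refine measure_mono fun ω hω => ?_
        refine lt_of_le_of_lt ?_ (show c * t < N ω from hω)
        nlinarith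
    _ = 2 * x * (1 / 2) := by
        rw [mul_comm 2 x, mul_assoc, one_div,
          ENNReal.mul_inv_cancel two_ne_zero ENNReal.ofNat_ne_top, mul_one]
    _ ≤ 2 * x * P (W ⁻¹' Icc (-K) K) := by gcongr
    _ = ∫⁻ _ in W ⁻¹' Icc (-K) K, 2 * x ∂P := (setLIntegral_const _ _).symm
    _ ≤ ∫⁻ ω in W ⁻¹' Icc (-K) K, condDistrib V W P (W ω) (Ioi (t + K)) ∂P :=
        lintegral_mono_ae (ae_restrict_of_ae h2)

/-- Layer cake: E(A - c)⁺ is the integral of P(A > t) over t > c. -/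
theorem integral_excess_le_of_tail_le {A B : Ω → ℝ} (hiA : Integrable A P) (hiB : Integrable B P)
    {c : ℝ} (h : ∀ t ≥ c, P {ω | t < A ω} ≤ P {ω | t < B ω}) :
    ∫ ω, max (A ω - c) 0 ∂P ≤ ∫ ω, max (B ω - c) 0 ∂P := by
  have hA := integrable_excess hiA c
  have hB := integrable_excess hiB c
  have hnn : ∀ D : Ω → ℝ, 0 ≤ᵐ[P] fun ω => max (D ω - c) 0 := fun D =>
    ae_of_all _ fun ω => le_max_right _ _
  rw [integral_eq_lintegral_of_nonneg_ae (hnn A) hA.aestronglyMeasurable,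
    integral_eq_lintegral_of_nonneg_ae (hnn B) hB.aestronglyMeasurable]
  refine ENNReal.toReal_mono hB.lintegral_lt_top.ne ?_
  rw [lintegral_eq_lintegral_meas_lt P (hnn A) hA.aemeasurable,
    lintegral_eq_lintegral_meas_lt P (hnn B) hB.aemeasurable]
  refine setLIntegral_mono' measurableSet_Ioi fun t ht => ?_
  have hset : ∀ D : Ω → ℝ, {ω | t < max (D ω - c) 0} = {ω | t + c < D ω} := fun D => by
    ext ω
    have : ¬ t < 0 := not_lt.2 (le_of_lt ht)
    simp only [mem_ofPred_eq, lt_max_iff, this, or_false, lt_sub_iff_add_lt]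
  rw [hset, hset]
  exact h _ (by linarith [mem_Ioi.1 ht])

/-- From x = x⁺ - x⁻: with equal means, comparing upper excesses at c amounts to comparing lower
ones, so low levels can be treated through the lower tail. -/
theorem integral_excess_neg {A : Ω → ℝ} (hiA : Integrable A P) (c : ℝ) :
    ∫ ω, max (A ω - c) 0 ∂P = ∫ ω, A ω ∂P - c + ∫ ω, max (-A ω - -c) 0 ∂P := by
  have h1 : ∫ ω, A ω ∂P - c = ∫ ω, (A ω - c) ∂P := by
    rw [integral_sub hiA (integrable_const c)]; simp
  have h2 := integrable_excess (A := fun ω => -A ω) hiA.neg (-c)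
  rw [h1]
  refine Eq.trans ?_ (integral_add (hiA.sub (integrable_const c)) h2)
  refine integral_congr_ae (ae_of_all _ fun ω => ?_)
  simp only
  rcases le_total (A ω) c with h | h
  · rw [max_eq_right (by linarith), max_eq_left (by linarith)]; ring
  · rw [max_eq_left (by linarith), max_eq_right (by linarith)]; ring

/-- If the two tails of `B` dominate those of `A` beyond `t₀`, and `A` and `B` have the same mean,
then the superquantiles of `B` dominate those of `A` at all levels close to `0` or `1`. -/
theorem superquantile_le_of_tails_le {A B : Ω → ℝ} (hA : Measurable A) (hiA : Integrable A P)
    (hB : Measurable B) (hiB : Integrable B P) (hmean : ∫ ω, A ω ∂P = ∫ ω, B ω ∂P) {t₀ : ℝ}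
    (hup : ∀ t ≥ t₀, P {ω | t < A ω} ≤ P {ω | t < B ω})
    (hlow : ∀ t ≥ t₀, P {ω | t < -A ω} ≤ P {ω | t < -B ω})
    {a : ℝ} (ha : a ∈ Ioo (0 : ℝ) 1)
    (hext : 1 - P.real {ω | t₀ < B ω} < a ∨ a ≤ P.real {ω | t₀ < -B ω}) :
    superquantile P A a ≤ superquantile P B a := by
  refine superquantile_le_of_excess_le hA hiA hB hiB ha ?_
  have hq : ∀ x, quantile (cdfOf P B) a ≤ x ↔ a ≤ cdfOf P B x := fun x => by
    rw [cdfOf_eq_cdf_map hB]; exact quantile_le_iff _ ha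
  set c := quantile (cdfOf P B) a
  rcases hext with h | h
  -- At a high level the quantile of B is past t₀, so only dominated upper tails enter; at a low
  -- level it is below -t₀, and the lower tails play that role.
  · have hc : t₀ ≤ c := by
      by_contra! hlt
      have h1 := (hq t₀).1 hlt.le
      have h2 := probReal_compl_eq_one_sub (μ := P)
        (measurableSet_lt (measurable_const (a := t₀)) hB)
      have h3 : {ω | t₀ < B ω}ᶜ = {ω | B ω ≤ t₀} := by ext ω; simp
      rw [h3] at h2
      have h4 : cdfOf P B t₀ = P.real {ω | B ω ≤ t₀} := rfl
      linarith
    exact integral_excess_le_of_tail_le hiA hiB fun t ht => hup t (hc.trans ht)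
  · have hc : c ≤ -t₀ := by
      refine (hq _).2 (h.trans (measureReal_mono fun ω (hω : t₀ < -B ω) => ?_))
      change B ω ≤ -t₀
      linarith
    rw [integral_excess_neg hiA, integral_excess_neg hiB, hmean]
    refine add_le_add_right ?_ _
    exact integral_excess_le_of_tail_le hiA.neg hiB.neg fun t ht => hlow t (by linarith)

end Tails

end TwoSample

/-! ### Assembly of the three claims -/

open TwoSample in
theorem proposition5 {Ω : Type*} [MeasurableSpace Ω] (P : Measure Ω) [IsProbabilityMeasure P]
    (p : ℕ) (hp : 1 ≤ p)
    (X : Ω → EuclideanSpace ℝ (Fin p)) (Y : Ω → ℝ) (hX : Measurable X) (hY : Measurable Y)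
    (hY2 : MemLp Y 2 P) (hX2 : MemLp X 2 P)
    (hVY : 0 < variance Y P) (hVX : (TwoSample.varianceMatrix P X).det ≠ 0)
    (a₀ : ℝ) (b₀ : EuclideanSpace ℝ (Fin p))
    (hlin : P[Y | MeasurableSpace.comap X inferInstance]
      =ᵐ[P] fun ω => a₀ + TwoSample.linIndex X b₀ ω) :
    (∀ ε : ℝ, 0 < ε → ε < 1 / 2 →
      (0 : EuclideanSpace ℝ (Fin p)) ∈ TwoSample.regularizedSet P X Y ε ∧
      IsCompact (TwoSample.regularizedSet P X Y ε) ∧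
      Convex ℝ (TwoSample.regularizedSet P X Y ε)) ∧
    ((∀ ε ε' : ℝ, 0 < ε → ε < ε' → ε' < 1 / 2 →
      TwoSample.identifiedSet P X Y ⊆ TwoSample.regularizedSet P X Y ε ∧
      TwoSample.regularizedSet P X Y ε ⊆ TwoSample.regularizedSet P X Y ε') ∧
      (⋂ ε ∈ Ioo (0 : ℝ) (1 / 2), TwoSample.regularizedSet P X Y ε) =
        TwoSample.identifiedSet P X Y) ∧
    (∀ U : Ω → ℝ,
      (U = fun ω => TwoSample.centered P Y ω
        - TwoSample.linIndex (TwoSample.centered P X) b₀ ω) →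
      Continuous (TwoSample.cdfOf P Y) →
      TwoSample.ThinnerTail P (fun ω => ‖TwoSample.centered P X ω‖) U
        (TwoSample.linIndex (TwoSample.centered P X) b₀) →
      TwoSample.ThinnerTail P (fun ω => ‖TwoSample.centered P X ω‖) (fun ω => - U ω)
        (TwoSample.linIndex (TwoSample.centered P X) b₀) →
      ∃ ε₀ : ℝ, 0 < ε₀ ∧ ε₀ < 1 / 2 ∧ ∀ ε : ℝ, 0 < ε → ε ≤ ε₀ →
        TwoSample.identifiedSet P X Y = TwoSample.regularizedSet P X Y ε) := by
  have hXi : Integrable X P := hX2.integrable one_le_two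
  have hYi : Integrable Y P := hY2.integrable one_le_two
  have hX0 := measurable_centered (P := P) hX
  have hY0 := measurable_centered (P := P) hY
  have hXi0 := integrable_centered hXi
  have hYi0 := integrable_centered hYi
  have hreg : ∀ ε : ℝ, 0 < ε → ε < 1 / 2 → _ := fun ε h1 h2 =>
    regularizedSet_eq hp hX hY hYi hX2 hVX h1 h2
  have hI : ∀ ε : ℝ, 0 < ε → ∀ a ∈ Icc ε (1 - ε), a ∈ Ioo (0 : ℝ) 1 := fun ε hε a ha =>
    ⟨hε.trans_le ha.1, ha.2.trans_lt (by linarith)⟩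
  have hid : ∀ b, b ∈ identifiedSet P X Y ↔ ∀ a ∈ Ioo (0 : ℝ) 1,
      superquantile P (linIndex (centered P X) b) a ≤ superquantile P (centered P Y) a :=
    fun b => ⟨fun hb a ha => superquantile_le_of_mem_identifiedSet hX hY hXi hYi hb ha,
      mem_identifiedSet_of_superquantile_le hX hY hXi hYi⟩
  have hsub : ∀ ε : ℝ, 0 < ε → ε < 1 / 2 → identifiedSet P X Y ⊆ regularizedSet P X Y ε := by
    intro ε h1 h2 b hb
    rw [hreg ε h1 h2]
    exact fun a ha => (hid b).1 hb a (hI ε h1 a ha)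
  have hmono : ∀ ε ε' : ℝ, 0 < ε → ε ≤ ε' → ε' < 1 / 2 →
      regularizedSet P X Y ε ⊆ regularizedSet P X Y ε' := by
    intro ε ε' h1 h2 h3
    rw [hreg ε h1 (by linarith), hreg ε' (by linarith) h3]
    exact fun b hb a ha => hb a ⟨h2.trans ha.1, ha.2.trans (by linarith)⟩
  refine ⟨fun ε h1 h2 => ?_, ⟨fun ε ε' h1 h2 h3 =>
    ⟨hsub ε h1 (by linarith), hmono ε ε' h1 h2.le h3⟩, ?_⟩, ?_⟩
  · obtain ⟨M, hM⟩ := isBounded_regularizedSet hp hX hY hYi hX2 hVX h1 h2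
    have hset : regularizedSet P X Y ε = ⋂ a ∈ Icc ε (1 - ε),
        {b | superquantile P (linIndex (centered P X) b) a
          ≤ superquantile P (centered P Y) a} := by
      rw [hreg ε h1 h2]; ext b; simp
    refine ⟨?_, Metric.isCompact_of_isClosed_isBounded ?_
      (isBounded_iff_forall_norm_le.2 ⟨M, hM⟩), ?_⟩
    · rw [hreg ε h1 h2]
      intro a ha
      have h0 := superquantile_linIndex_smul (P := P) hX hXi (hI ε h1 a ha) le_rfl 0
      rw [zero_smul, zero_mul] at h0
      rw [h0]
      exact superquantile_nonneg hY0 hYi0 (integral_centered hYi) (hI ε h1 a ha)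
    · rw [hset]
      exact isClosed_biInter fun a ha => isClosed_le
        (continuous_superquantile_linIndex hX hXi (hI ε h1 a ha)) continuous_const
    · rw [hset]
      refine convex_iInter₂ fun a ha => ?_
      simpa using (convexOn_superquantile_linIndex (P := P) hX hXi (hI ε h1 a ha)).convex_le
        (superquantile P (centered P Y) a)
  · refine Subset.antisymm (fun b hb => (hid b).2 fun a ha => ?_)
      (subset_iInter₂ fun ε hε => hsub ε hε.1 hε.2)
    -- With ε = min(a, 1 - a)/2, the interval [ε, 1 - ε] contains a; the halving keeps ε strictly
    -- below 1/2.
    have hpos : 0 < min a (1 - a) / 2 := half_pos (lt_min ha.1 (sub_pos.2 ha.2))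
    have h1 := min_le_left a (1 - a)
    have h2 := min_le_right a (1 - a)
    have h3 : min a (1 - a) / 2 < 1 / 2 := by linarith [ha.1, ha.2]
    have hb' := mem_iInter₂.1 hb (min a (1 - a) / 2) ⟨hpos, h3⟩
    rw [hreg _ hpos h3] at hb'
    exact hb' a ⟨by linarith, by linarith⟩
  · rintro U hU - hT1 hT2
    set W := linIndex (centered P X) b₀ with hW
    have hWm : Measurable W := measurable_linIndex hX0 b₀
    have hUm : Measurable U := by rw [hU]; exact hY0.sub hWm
    have hZ1 : ∀ ω, U ω - |W ω| ≤ centered P Y ω := fun ω => by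
      rw [hU]; linarith [neg_abs_le (W ω)]
    have hZ2 : ∀ ω, -U ω - |W ω| ≤ -centered P Y ω := fun ω => by
      rw [hU]; linarith [le_abs_self (W ω)]
    -- The bound is taken at 1/4 and reaches all smaller ε by inclusion, so M, and hence the tail
    -- threshold t₀, does not depend on ε.
    obtain ⟨M', hM'⟩ := isBounded_regularizedSet hp hX hY hYi hX2 hVX
      (show (0 : ℝ) < 1 / 4 by norm_num) (by norm_num)
    set M := max M' 1 with hM
    have hM0 : 0 < M := lt_max_of_lt_right one_pos
    obtain ⟨t₁, ht₁⟩ := hT1.exists_measure_le hUm hWm hZ1 (inv_pos.2 hM0)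
    obtain ⟨t₂, ht₂⟩ := hT2.exists_measure_le hUm.neg hWm hZ2 (inv_pos.2 hM0)
    set t₀ := max t₁ t₂ with ht₀
    have hp1 : 0 < P.real {ω | t₀ < centered P Y ω} :=
      ENNReal.toReal_pos (hT1.measure_pos hUm hWm hZ1 t₀).ne' (measure_ne_top _ _)
    have hp2 : 0 < P.real {ω | t₀ < -centered P Y ω} :=
      ENNReal.toReal_pos (hT2.measure_pos hUm.neg hWm hZ2 t₀).ne' (measure_ne_top _ _)
    -- Below the two tail probabilities of Y₀ at t₀, every level outside [ε, 1 - ε] is extreme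
    -- enough for the tail comparison.
    refine ⟨min (1 / 4) (min (P.real {ω | t₀ < centered P Y ω})
      (P.real {ω | t₀ < -centered P Y ω})), lt_min (by norm_num) (lt_min hp1 hp2),
      (min_le_left _ _).trans_lt (by norm_num), fun ε h1 h2 => ?_⟩
    have h3 : ε ≤ 1 / 4 := h2.trans (min_le_left _ _)
    have h4 := h2.trans ((min_le_right _ _).trans (min_le_left _ _))
    have h5 := h2.trans ((min_le_right _ _).trans (min_le_right _ _))
    refine Subset.antisymm (hsub ε h1 (by linarith)) fun b hb => (hid b).2 fun a ha => ?_
    have hbM : ‖b‖ ≤ M :=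
      (hM' b (hmono ε (1 / 4) h1 h3 (by norm_num) hb)).trans (le_max_left _ _)
    rw [hreg ε h1 (by linarith)] at hb
    by_cases hmem : a ∈ Icc ε (1 - ε)
    · exact hb a hmem
    -- By Cauchy–Schwarz |X₀'b| ≤ M‖X₀‖, which is why the tail comparison was applied with the
    -- constant M⁻¹.
    have hbound : ∀ t ω, t < |linIndex (centered P X) b ω| → M⁻¹ * t < ‖centered P X ω‖ := by
      intro t ω h
      rw [inv_mul_lt_iff₀ hM0]
      refine h.trans_le ((abs_real_inner_le_norm _ _).trans ?_)
      rw [mul_comm]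
      exact mul_le_mul_of_nonneg_right hbM (norm_nonneg _)
    refine superquantile_le_of_tails_le (t₀ := t₀) (measurable_linIndex hX0 b)
      (integrable_linIndex hXi0 b) hY0 hYi0
      ((integral_linIndex_centered hXi b).trans (integral_centered hYi).symm)
      (fun t ht => (measure_mono fun ω (hω : t < _) => hbound t ω (hω.trans_le (le_abs_self _))).trans
        (ht₁ t ((le_max_left _ _).trans ht)))
      (fun t ht => (measure_mono fun ω (hω : t < _) => hbound t ω (hω.trans_le (neg_le_abs _))).trans
        (ht₂ t ((le_max_right _ _).trans ht))) ha ?_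
    rcases lt_or_ge a ε with h | h
    · exact Or.inr (h.le.trans h5)
    · refine Or.inl ?_
      have : 1 - ε < a := by
        by_contra! h'
        exact hmem ⟨h, h'⟩
      linarith

end
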